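/- Let $a,b,c$ be nonzero real numbers and let $$W(x)=e^{-x^2}\begin{pmatrix} e^{2bx}+a^2x^2 & ax & acx^2\\ ax & 1 & cx\\ acx^2 & cx & c^2x^2+1\end{pmatrix},\qquad x\in\mathbb R .$$ For $P,Q\in \mathrm{Mat}_3(\mathbb C[x])$ put $\langle P,Q\rangle=\int_{\mathbb R}P(x)W(x)Q(x)^*\,dx$. A sequence of matrix orthogonal polynomials for $W$ is a sequence $(Q_n)_{n\ge 0}$ in $\mathrm{Mat}_3(\mathbb C[x])$ such that $Q_n$ has degree $n$ and nonsingular leading coefficient and $\langle Q_n,Q_m\rangle=0$ for $n\neq m$. Differential operators $D=\sum_{j=0}^m\partial^jF_j(x)$, with $\partial=\frac{d}{dx}$ and $F_j\in\mathrm{Mat}_3(\mathbb C[x])$, act on the right by $P\cdot D=\sum_{j=0}^m P^{(j)}(x)F_j(x)$, and $D$ is called $W$-symmetric if $\langle P\cdot D,Q\rangle=\langle P,Q\cdot D\rangle$ for all $P,Q\in \mathrm{Mat}_3(\mathbb C[x])$. Let $$D_1=\partial^2 I+\partial\begin{pmatrix}2b-2x&-2bax+2a&0\\0&-2x&0\\0&2c&-2x\end{pmatrix}+\begin{pmatrix}0&0&0\\0&2&0\\0&0&0\end{pmatrix},$$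 $$D_2=\partial^2\begin{pmatrix}0&ax&0\\0&1&0\\0&cx&0\end{pmatrix}+\partial\begin{pmatrix}0&2a&-\frac{2ax}{c}\\0&0&-\frac2c\\0&2c+\frac2c&-2x\end{pmatrix}+\begin{pmatrix}2+\frac4{c^2}&0&-\frac{2a}{c}\\0&2+\frac4{c^2}&0\\0&0&0\end{pmatrix}.$$ Then $D_1$ and $D_2$ are $W$-symmetric. Sequences of matrix orthogonal polynomials for $W$ exist, and for every such sequence $(Q_n)_{n\ge0}$ the algebra $$\mathcal D(W)=\{D=\textstyle\sum_{j=0}^m\partial^jF_j(x)\;:\;\text{for every } n\ge 0 \text{ there is } \Gamma_n\in\mathrm{Mat}_3(\mathbb C)\text{ with } Q_n\cdot D=\Gamma_nQ_n\}$$ contains $D_1$ and $D_2$ and is generated as a $\mathbb C[D_1]$-module by $\{I,D_2\}$. Moreover, every $D\in\mathcal D(W)$ can be written as $$D=p_1(D_1)+p_2(D_1)\Bigl(D_2-\tfrac{2(c^2+2)}{c^2}I\Bigr)\qquad\text{with } p_1,p_2\in\mathbb C[x].$$ -/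

import Mathlib

open Polynomial MeasureTheory

noncomputable section

namespace MatrixBochner

/-- `Mat_N(ℂ[x])`. -/
abbrev MatPoly (N : ℕ) : Type := Matrix (Fin N) (Fin N) ℂ[X]

/-- `ℂ`-linear operators acting on the right of `Mat_N(ℂ[x])`: the opposite algebra of the
endomorphism algebra, so that `P · (D * E) = (P · D) · E`. -/
abbrev RightOp (N : ℕ) : Type := (Module.End ℂ (MatPoly N))ᵐᵒᵖ

/-- The right action `P · D`. -/
def act {N : ℕ} (P : MatPoly N) (D : RightOp N) : MatPoly N := D.unop P

/-- The operator `∂ = d/dx`, acting entrywise. -/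
def partialOp (N : ℕ) : RightOp N :=
  MulOpposite.op (LinearMap.mapMatrix (Polynomial.derivative : ℂ[X] →ₗ[ℂ] ℂ[X]))

/-- The operator of order zero `P · F = P F` given by a matrix polynomial `F`. -/
def coefOp {N : ℕ} (F : MatPoly N) : RightOp N :=
  MulOpposite.op (LinearMap.mulRight ℂ F)

/-- The operator `∑_{j ≤ m} ∂^j F_j(x)`, that is `P ↦ ∑_{j ≤ m} P^{(j)}(x) F_j(x)`. -/
def sumOp {N : ℕ} (m : ℕ) (F : ℕ → MatPoly N) : RightOp N :=
  ∑ j ∈ Finset.range (m + 1), partialOp N ^ j * coefOp (F j)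

/-- `D` is a differential operator `∑_{j ≤ m} ∂^j F_j(x)` with polynomial coefficients. -/
def IsDiffOp {N : ℕ} (D : RightOp N) : Prop :=
  ∃ (m : ℕ) (F : ℕ → MatPoly N), D = sumOp m F

theorem coefOp_mul {N : ℕ} (F G : MatPoly N) : coefOp F * coefOp G = coefOp (F * G) := by
  apply MulOpposite.unop_injective
  ext1 P
  simp [coefOp, mul_assoc]

theorem coefOp_add {N : ℕ} (F G : MatPoly N) : coefOp (F + G) = coefOp F + coefOp G := by
  apply MulOpposite.unop_injective
  ext1 P
  simp [coefOp, mul_add]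

theorem coefOp_zero {N : ℕ} : coefOp (0 : MatPoly N) = 0 := by
  apply MulOpposite.unop_injective
  ext1 P
  simp [coefOp]

theorem coefOp_scalar {N : ℕ} (r : ℂ) :
    coefOp (algebraMap ℂ (MatPoly N) r) = algebraMap ℂ (RightOp N) r := by
  apply MulOpposite.unop_injective
  ext1 P
  simp [coefOp, Algebra.algebraMap_eq_smul_one]

theorem coefOp_mul_partialOp {N : ℕ} (F : MatPoly N) :
    coefOp F * partialOp N = partialOp N * coefOp F + coefOp (act F (partialOp N)) := by
  apply MulOpposite.unop_injective
  refine LinearMap.ext fun P => ?_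
  ext1 i j
  simp [coefOp, partialOp, act, Matrix.mul_apply, Finset.sum_add_distrib]

theorem isDiffOp_term {N : ℕ} (k : ℕ) (F : MatPoly N) :
    IsDiffOp (partialOp N ^ k * coefOp F) := by
  refine ⟨k, fun j => if j = k then F else 0, ?_⟩
  unfold sumOp
  rw [Finset.sum_eq_single k]
  · simp
  · intro j _ hj
    simp [hj, coefOp_zero]
  · simp

theorem isDiffOp_zero {N : ℕ} : IsDiffOp (0 : RightOp N) :=
  ⟨0, 0, by simp [sumOp, coefOp_zero]⟩

theorem IsDiffOp.add {N : ℕ} {D E : RightOp N} (hD : IsDiffOp D) (hE : IsDiffOp E) :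
    IsDiffOp (D + E) := by
  have key : ∀ (m k : ℕ) (F : ℕ → MatPoly N), m ≤ k →
      sumOp m F = sumOp k (fun j => if j ≤ m then F j else 0) := by
    intro m k F h
    unfold sumOp
    rw [← Finset.sum_subset (Finset.range_mono (Nat.succ_le_succ h))]
    · refine Finset.sum_congr rfl fun j hj => ?_
      simp only [if_pos (Nat.lt_succ_iff.mp (Finset.mem_range.mp hj))]
    · intro j _ hj
      have : ¬ j ≤ m := fun h' => hj (Finset.mem_range.mpr (Nat.lt_succ_of_le h'))
      simp [this, coefOp_zero]
  obtain ⟨m, F, rfl⟩ := hD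
  obtain ⟨k, G, rfl⟩ := hE
  rw [key m (max m k) F (le_max_left _ _), key k (max m k) G (le_max_right _ _)]
  refine ⟨max m k, fun j => (if j ≤ m then F j else 0) + (if j ≤ k then G j else 0), ?_⟩
  simp only [sumOp, coefOp_add, mul_add, Finset.sum_add_distrib]

theorem isDiffOp_sum {N : ℕ} (s : Finset ℕ) (f : ℕ → RightOp N) (h : ∀ j, IsDiffOp (f j)) :
    IsDiffOp (∑ j ∈ s, f j) :=
  Finset.sum_induction f IsDiffOp (fun _ _ ha hb => ha.add hb) isDiffOp_zero fun j _ => h j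

theorem IsDiffOp.mul_coefOp {N : ℕ} {D : RightOp N} (hD : IsDiffOp D) (G : MatPoly N) :
    IsDiffOp (D * coefOp G) := by
  obtain ⟨m, F, rfl⟩ := hD
  rw [sumOp, Finset.sum_mul]
  refine isDiffOp_sum _ _ fun j => ?_
  rw [mul_assoc, coefOp_mul]
  exact isDiffOp_term _ _

theorem IsDiffOp.mul_partialOp {N : ℕ} {D : RightOp N} (hD : IsDiffOp D) :
    IsDiffOp (D * partialOp N) := by
  obtain ⟨m, F, rfl⟩ := hD
  rw [sumOp, Finset.sum_mul]
  refine isDiffOp_sum _ _ fun j => ?_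
  rw [mul_assoc, coefOp_mul_partialOp, mul_add, ← mul_assoc, ← pow_succ]
  exact (isDiffOp_term _ _).add (isDiffOp_term _ _)

theorem IsDiffOp.mul {N : ℕ} {D E : RightOp N} (hD : IsDiffOp D) (hE : IsDiffOp E) :
    IsDiffOp (D * E) := by
  have hpow : ∀ j : ℕ, IsDiffOp (D * partialOp N ^ j) := by
    intro j
    induction j with
    | zero => simpa using hD
    | succ k ih =>
      rw [pow_succ, ← mul_assoc]
      exact ih.mul_partialOp
  obtain ⟨m, G, rfl⟩ := hE
  rw [sumOp, Finset.mul_sum]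
  refine isDiffOp_sum _ _ fun j => ?_
  rw [← mul_assoc]
  exact (hpow j).mul_coefOp _

/-- `Mat_N(Ω[x])`: the algebra of differential operators `∑_{j ≤ m} ∂^j F_j(x)` with polynomial
coefficients, acting on the right of `Mat_N(ℂ[x])`. This action is faithful
(see `coeff_unique`), so an operator is identified with its action. -/
def diffOps (N : ℕ) : Subalgebra ℂ (RightOp N) where
  carrier := {D | IsDiffOp D}
  mul_mem' hD hE := hD.mul hE
  add_mem' hD hE := hD.add hE
  algebraMap_mem' r := by
    have h := isDiffOp_term 0 (algebraMap ℂ (MatPoly N) r)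
    rw [pow_zero, one_mul, coefOp_scalar] at h
    exact h

theorem act_sumOp {N : ℕ} (P : MatPoly N) (m : ℕ) (F : ℕ → MatPoly N) :
    act P (sumOp m F) =
      ∑ j ∈ Finset.range (m + 1), (P.map fun p => Polynomial.derivative^[j] p) * F j := by
  have hpow : ∀ j : ℕ, (partialOp N ^ j).unop P = P.map fun p => Polynomial.derivative^[j] p := by
    intro j
    induction j with
    | zero => ext1 i k; simp
    | succ n ih =>
      rw [pow_succ, MulOpposite.unop_mul, Module.End.mul_apply, ih]
      ext1 i k
      simp [partialOp, Function.iterate_succ_apply']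
  simp [act, sumOp, coefOp, ← hpow]

/-- The coefficients of a differential operator are determined by its action. -/
theorem coeff_unique {N : ℕ} (m : ℕ) (F G : ℕ → MatPoly N) (h : sumOp m F = sumOp m G) :
    ∀ j ≤ m, F j = G j := by
  intro n
  induction n using Nat.strong_induction_on with
  | _ n ih =>
    intro hn
    have hterm : ∀ (H : MatPoly N) (j : ℕ),
        ((Matrix.diagonal fun _ : Fin N => (X ^ n : ℂ[X])).map
          fun p => Polynomial.derivative^[j] p) * H
          = (Polynomial.derivative^[j] (X ^ n : ℂ[X])) • H := by
      intro H j
      rw [Matrix.diagonal_map (by simp), Matrix.smul_eq_diagonal_mul]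
    have hact := congrArg (act (Matrix.diagonal fun _ : Fin N => (X ^ n : ℂ[X]))) h
    rw [act_sumOp, act_sumOp, ← sub_eq_zero, ← Finset.sum_sub_distrib] at hact
    rw [Finset.sum_eq_single n] at hact
    · rw [hterm, hterm, sub_eq_zero] at hact
      rw [Polynomial.iterate_derivative_X_pow_eq_C_mul, Nat.descFactorial_self, Nat.sub_self,
        pow_zero, mul_one] at hact
      ext1 i k
      have hik := congrFun (congrFun hact i) k
      simp only [Matrix.smul_apply, smul_eq_mul] at hik
      refine mul_left_cancel₀ ?_ hik
      rw [Polynomial.C_ne_zero]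
      exact_mod_cast n.factorial_ne_zero
    · intro j hj hjn
      rw [hterm, hterm]
      rcases lt_or_gt_of_ne hjn with hlt | hgt
      · rw [ih j hlt (hlt.le.trans hn), sub_self]
      · rw [Polynomial.iterate_derivative_eq_zero (by simpa using hgt)]
        simp
    · intro hj
      exact absurd (Finset.mem_range.mpr (Nat.lt_succ_of_le hn)) hj

/-- The value `P(x)` at a real point. -/
def evalAt {N : ℕ} (P : MatPoly N) (x : ℝ) : Matrix (Fin N) (Fin N) ℂ :=
  P.map fun p => p.eval (x : ℂ)

/-- `⟨P, Q⟩_W = ∫ P(x) W(x) Q(x)^* dx` over the real line, integrated entrywise. -/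
def form {N : ℕ} (W : ℝ → Matrix (Fin N) (Fin N) ℂ) (P Q : MatPoly N) :
    Matrix (Fin N) (Fin N) ℂ :=
  Matrix.of fun i j => ∫ x : ℝ, (evalAt P x * W x * (evalAt Q x).conjTranspose) i j

/-- The matrix coefficient of `x^k` in `P`. -/
def coeffMat {N : ℕ} (P : MatPoly N) (k : ℕ) : Matrix (Fin N) (Fin N) ℂ :=
  P.map fun p => p.coeff k

/-- `(Q_n)` is a sequence of matrix orthogonal polynomials for `W`: `Q_n` has degree `n` with
nonsingular leading coefficient, and `⟨Q_n, Q_m⟩ = 0` for `n ≠ m`. -/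
structure IsOrthogonalSequence {N : ℕ} (W : ℝ → Matrix (Fin N) (Fin N) ℂ)
    (Q : ℕ → MatPoly N) : Prop where
  degree_le : ∀ n k : ℕ, n < k → coeffMat (Q n) k = 0
  leading : ∀ n : ℕ, (coeffMat (Q n) n).det ≠ 0
  orthogonal : ∀ n m : ℕ, n ≠ m → form W (Q n) (Q m) = 0

/-- A constant matrix, as a matrix polynomial. -/
def constMat {N : ℕ} (M : Matrix (Fin N) (Fin N) ℂ) : MatPoly N := M.map Polynomial.C

theorem act_constMat_mul {N : ℕ} {D : RightOp N} (hD : IsDiffOp D)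
    (M : Matrix (Fin N) (Fin N) ℂ) (P : MatPoly N) :
    act (constMat M * P) D = constMat M * act P D := by
  obtain ⟨m, F, rfl⟩ := hD
  rw [act_sumOp, act_sumOp, Finset.mul_sum]
  refine Finset.sum_congr rfl fun j _ => ?_
  rw [← mul_assoc]
  congr 1
  ext1 i k
  simp [constMat, Matrix.mul_apply, Polynomial.iterate_derivative_sum,
    Polynomial.iterate_derivative_C_mul]

/-- The algebra of the differential operators with polynomial coefficients that have every
`Q_n` as an eigenfunction, `Q_n · D = Γ_n Q_n` with constant matrices `Γ_n`. For a sequence of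
orthogonal polynomials for `W` this is `D(W)`. -/
def eigenAlgebra {N : ℕ} (Q : ℕ → MatPoly N) : Subalgebra ℂ (RightOp N) where
  carrier := {D | D ∈ diffOps N ∧
    ∀ n : ℕ, ∃ M : Matrix (Fin N) (Fin N) ℂ, act (Q n) D = constMat M * Q n}
  mul_mem' := by
    rintro D E ⟨hD, hD'⟩ ⟨hE, hE'⟩
    refine ⟨mul_mem hD hE, fun n => ?_⟩
    obtain ⟨M, hM⟩ := hD' n
    obtain ⟨L, hL⟩ := hE' n
    refine ⟨M * L, ?_⟩
    have h : act (Q n) (D * E) = act (act (Q n) D) E := rfl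
    rw [h, hM, act_constMat_mul hE, hL, ← mul_assoc]
    simp [constMat, Matrix.map_mul]
  add_mem' := by
    rintro D E ⟨hD, hD'⟩ ⟨hE, hE'⟩
    refine ⟨add_mem hD hE, fun n => ?_⟩
    obtain ⟨M, hM⟩ := hD' n
    obtain ⟨L, hL⟩ := hE' n
    refine ⟨M + L, ?_⟩
    have h : act (Q n) (D + E) = act (Q n) D + act (Q n) E := rfl
    rw [h, hM, hL, ← add_mul]
    congr 1
    ext1 i j
    simp [constMat]
  algebraMap_mem' r := by
    refine ⟨algebraMap_mem _ r, fun n => ⟨Matrix.diagonal fun _ => r, ?_⟩⟩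
    have h : act (Q n) (algebraMap ℂ (RightOp N) r) = r • Q n := rfl
    rw [h, constMat, Matrix.diagonal_map (by simp)]
    ext1 i j
    simp [Matrix.diagonal_mul, Polynomial.smul_eq_C_mul]

/-- `D` is `W`-symmetric: `⟨P · D, Q⟩ = ⟨P, Q · D⟩` for all matrix polynomials `P`, `Q`. -/
def IsSymmetricOp {N : ℕ} (W : ℝ → Matrix (Fin N) (Fin N) ℂ) (D : RightOp N) : Prop :=
  ∀ P Q : MatPoly N, form W (act P D) Q = form W P (act Q D)

/-- The `3 × 3` Hermite-type weight matrix. -/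
def hermiteWeight (a b c : ℝ) (x : ℝ) : Matrix (Fin 3) (Fin 3) ℂ :=
  (Real.exp (-x ^ 2) •
    !![Real.exp (2 * b * x) + a ^ 2 * x ^ 2, a * x, a * c * x ^ 2;
       a * x, 1, c * x;
       a * c * x ^ 2, c * x, c ^ 2 * x ^ 2 + 1]).map fun r : ℝ => (r : ℂ)

/-- A real number as a constant polynomial. -/
def cst (r : ℝ) : ℂ[X] := Polynomial.C (r : ℂ)

/-- The operator `D₁`. -/
def opD₁ (a b c : ℝ) : RightOp 3 :=
  partialOp 3 ^ 2
  + partialOp 3 * coefOp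
      !![cst (2 * b) - cst 2 * X, cst (-2 * b * a) * X + cst (2 * a), 0;
         0, cst (-2) * X, 0;
         0, cst (2 * c), cst (-2) * X]
  + coefOp
      !![0, 0, 0;
         0, cst 2, 0;
         0, 0, 0]

/-- The operator `D₂`. -/
def opD₂ (a c : ℝ) : RightOp 3 :=
  partialOp 3 ^ 2 * coefOp
      !![0, cst a * X, 0;
         0, 1, 0;
         0, cst c * X, 0]
  + partialOp 3 * coefOp
      !![0, cst (2 * a), cst (-(2 * a / c)) * X;
         0, 0, cst (-(2 / c));
         0, cst (2 * c + 2 / c), cst (-2) * X]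
  + coefOp
      !![cst (2 + 4 / c ^ 2), 0, cst (-(2 * a / c));
         0, cst (2 + 4 / c ^ 2), 0;
         0, 0, 0]

end MatrixBochner

end

open MatrixBochner

/-! The weight factors as `W = T diag(e^{-x²+2bx}, e^{-x²}, e^{-x²}) T^*` with `T` a unipotent
polynomial matrix (`hermiteWeight_eq`). Multiplying on the right by `T` turns the form into a sum of
three scalar Gaussian integrals, so everything is expressed through derivatives, raising operators
and Hermite polynomials, centred at `b` in the first column and at `0` in the other two. In this
picture `D₁` consists of three scalar Hermite operators, and `D₂` couples only the last two columns;
symmetry is integration by parts. The sequence `hermSeq` is orthogonal, and orthogonal sequences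
differ only by constant left factors, so its eigenvalue algebra is that of every other.

Let `D` be in the algebra, with scalar components `e i j` after conjugation by `T`. The eigenvalue
equations bound how far a component can lower the Hermite index. Between different centres such a
bound is impossible for a nonzero element of the Weyl algebra: changing the centre makes each
coefficient `(γ - β)^n` times a finite combination of binomials in `n` (`eq_zero_of_banded_of_ne`).
Since `b ≠ 0`, the components joining the first column to the others vanish (`IsEigenFamily.block`).

The remaining equations force `e 0 0` and `e 2 2` to be diagonal on Hermite polynomials of index at
least 1, with eigenvalues `P(n)` and `K(n)` polynomial in `n` (`IsEigenFamily.diagonal`), and `D =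
0` if both components vanish there (`IsEigenFamily.eq_zero`). So `D` is determined by `(P, K)`. On
these two components `D₁` has eigenvalue `-2n`, while `D₂ - 2(c²+2)/c²` acts as `0` and `-4/c²`;
hence suitable `p₁`, `p₂` realise every pair `(P, K)`. -/

open Polynomial MeasureTheory
noncomputable section
namespace MatrixBochner

/-! ### Gaussian integrals and the raising operator. -/

/-- The Gaussian density `e^{-x^2+2βx}`. -/
def gaussWeight (β x : ℝ) : ℝ := Real.exp (-x ^ 2) * Real.exp (2 * β * x)

theorem gaussWeight_pos (β x : ℝ) : 0 < gaussWeight β x := by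
  unfold gaussWeight; positivity

theorem continuous_gaussWeight (β : ℝ) : Continuous (gaussWeight β) := by
  unfold gaussWeight; fun_prop

theorem hasDerivAt_gaussWeight (β x : ℝ) :
    HasDerivAt (gaussWeight β) ((2 * β - 2 * x) * gaussWeight β x) x := by
  have h1 : HasDerivAt (fun x : ℝ => Real.exp (-x ^ 2)) (Real.exp (-x ^ 2) * (-(2 * x))) x := by
    simpa using ((hasDerivAt_pow 2 x).neg).exp
  have h2 : HasDerivAt (fun x : ℝ => Real.exp (2 * β * x))
      (Real.exp (2 * β * x) * (2 * β)) x := by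
    simpa using ((hasDerivAt_id x).const_mul (2 * β)).exp
  refine (h1.mul h2).congr_deriv ?_
  unfold gaussWeight
  ring

theorem gaussWeight_eq (β x : ℝ) :
    gaussWeight β x = Real.exp (β ^ 2) * Real.exp (-1 * (x - β) ^ 2) := by
  unfold gaussWeight
  rw [← Real.exp_add, ← Real.exp_add]
  congr 1
  ring

theorem integrable_eval_mul_exp_neg_sq (p : ℂ[X]) :
    Integrable fun x : ℝ => p.eval (x : ℂ) * ((Real.exp (-1 * x ^ 2) : ℝ) : ℂ) := by
  induction p using Polynomial.induction_on' with
  | add p q hp hq =>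
    simp only [eval_add, add_mul]
    exact hp.add hq
  | monomial n a =>
    have h := integrable_rpow_mul_exp_neg_mul_sq (b := 1) one_pos (s := n)
      (lt_of_lt_of_le (by norm_num) n.cast_nonneg)
    simp only [Real.rpow_natCast] at h
    have h' := h.ofReal (𝕜 := ℂ) |>.const_mul a
    convert h' using 2 with x
    simp [mul_assoc]

/-- Completing the square reduces to the centred Gaussian, after a translation of the polynomial by
`β`. -/
theorem integrable_eval_mul_gaussWeight (β : ℝ) (p : ℂ[X]) :
    Integrable fun x : ℝ => p.eval (x : ℂ) * (gaussWeight β x : ℂ) := by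
  have h := ((integrable_eval_mul_exp_neg_sq (p.comp (X + C (β : ℂ)))).comp_sub_right β).const_mul
    ((Real.exp (β ^ 2) : ℝ) : ℂ)
  convert h using 2 with x
  rw [gaussWeight_eq]
  simp only [eval_comp, eval_add, eval_X, eval_C, Complex.ofReal_sub, sub_add_cancel,
    Complex.ofReal_mul]
  ring

/-- The functional `p ↦ ∫ p(x) e^{-x^2+2βx} dx`. -/
def gaussInt (β : ℝ) : ℂ[X] →ₗ[ℂ] ℂ where
  toFun p := ∫ x : ℝ, p.eval (x : ℂ) * (gaussWeight β x : ℂ)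
  map_add' p q := by
    simp only [eval_add, add_mul]
    exact integral_add (integrable_eval_mul_gaussWeight β p) (integrable_eval_mul_gaussWeight β q)
  map_smul' r p := by
    simp only [eval_smul, smul_eq_mul, mul_assoc, RingHom.id_apply]
    exact integral_const_mul _ _

theorem gaussInt_apply (β : ℝ) (p : ℂ[X]) :
    gaussInt β p = ∫ x : ℝ, p.eval (x : ℂ) * (gaussWeight β x : ℂ) := rfl

/-- The raising operator `p ↦ (x - β) p - p' / 2`, one half of the adjoint of `∂` for the density
`e^{-x^2+2βx}`. -/
def raise (β : ℝ) : Module.End ℂ ℂ[X] :=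
  LinearMap.mulLeft ℂ (X - C (β : ℂ)) - (1 / 2 : ℂ) • Polynomial.derivative

theorem raise_apply (β : ℝ) (p : ℂ[X]) :
    raise β p = (X - C (β : ℂ)) * p - (1 / 2 : ℂ) • derivative p := rfl

/-- The integrand is `-1/2` times the derivative of `p(x) e^{-x²+2βx}`, which is integrable together
with its derivative. -/
theorem gaussInt_raise (β : ℝ) (p : ℂ[X]) : gaussInt β (raise β p) = 0 := by
  have hd : ∀ x : ℝ, HasDerivAt (fun x : ℝ => p.eval (x : ℂ) * (gaussWeight β x : ℂ))
      ((-2 : ℂ) * ((raise β p).eval (x : ℂ) * (gaussWeight β x : ℂ))) x := by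
    intro x
    have h1 : HasDerivAt (fun x : ℝ => p.eval (x : ℂ)) (p.derivative.eval (x : ℂ)) x :=
      (p.hasDerivAt (x : ℂ)).comp_ofReal
    have h2 := (hasDerivAt_gaussWeight β x).ofReal_comp
    refine (h1.mul h2).congr_deriv ?_
    rw [raise_apply]
    simp only [eval_sub, eval_mul, eval_X, eval_C, eval_smul, smul_eq_mul]
    push_cast
    ring
  have h := integral_eq_zero_of_hasDerivAt_of_integrable hd
    ((integrable_eval_mul_gaussWeight β (raise β p)).const_mul _)
    (integrable_eval_mul_gaussWeight β p)
  rw [integral_const_mul] at h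
  simpa [gaussInt_apply] using h

theorem gaussInt_derivative_mul (β : ℝ) (p q : ℂ[X]) :
    gaussInt β (derivative p * q) = 2 * gaussInt β (p * raise β q) := by
  have h := gaussInt_raise β (p * q)
  have h' : derivative p * q = (2 : ℂ) • (p * raise β q) - (2 : ℂ) • raise β (p * q) := by
    simp only [raise_apply, derivative_mul, smul_eq_C_mul]
    have : (C 2 * C (1 / 2) : ℂ[X]) = 1 := by rw [← C_mul]; norm_num
    linear_combination (-derivative p * q) * this
  rw [h', map_sub, map_smul, map_smul, h]
  simp

theorem gaussInt_mul_derivative (β : ℝ) (p q : ℂ[X]) :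
    gaussInt β (p * derivative q) = 2 * gaussInt β (raise β p * q) := by
  rw [mul_comm, gaussInt_derivative_mul, mul_comm q]

/-- The polynomial with complex conjugate coefficients. -/
def conjPoly (p : ℂ[X]) : ℂ[X] := p.map (starRingEnd ℂ)

theorem eval_conjPoly (p : ℂ[X]) (x : ℝ) :
    (conjPoly p).eval (x : ℂ) = starRingEnd ℂ (p.eval (x : ℂ)) := by
  rw [conjPoly, eval_map, ← Polynomial.eval₂_hom, Complex.conj_ofReal]

theorem conjPoly_derivative (p : ℂ[X]) : conjPoly (derivative p) = derivative (conjPoly p) :=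
  (derivative_map p _).symm

theorem conjPoly_add (p q : ℂ[X]) : conjPoly (p + q) = conjPoly p + conjPoly q := by
  simp [conjPoly]

theorem conjPoly_sub (p q : ℂ[X]) : conjPoly (p - q) = conjPoly p - conjPoly q := by
  simp [conjPoly]

theorem conjPoly_mul (p q : ℂ[X]) : conjPoly (p * q) = conjPoly p * conjPoly q := by
  simp [conjPoly]

theorem conjPoly_smul (r : ℂ) (p : ℂ[X]) :
    conjPoly (r • p) = (starRingEnd ℂ r) • conjPoly p := by
  simp [conjPoly, smul_eq_C_mul]

theorem conjPoly_raise (β : ℝ) (p : ℂ[X]) : conjPoly (raise β p) = raise β (conjPoly p) := by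
  simp only [raise_apply, conjPoly_sub, conjPoly_mul, ← conjPoly_derivative]
  rw [conjPoly_smul]
  simp [conjPoly, map_ofNat (starRingEnd ℂ)]

theorem gaussInt_mul_conjPoly (β : ℝ) (p : ℂ[X]) :
    gaussInt β (p * conjPoly p) =
      ((∫ x : ℝ, Complex.normSq (p.eval (x : ℂ)) * gaussWeight β x : ℝ) : ℂ) := by
  rw [gaussInt_apply, ← integral_complex_ofReal]
  congr 1
  ext x
  rw [eval_mul, eval_conjPoly, Complex.mul_conj]
  push_cast
  rfl

theorem integrable_normSq_mul_gaussWeight (β : ℝ) (p : ℂ[X]) :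
    Integrable fun x : ℝ => Complex.normSq (p.eval (x : ℂ)) * gaussWeight β x := by
  have h := (integrable_eval_mul_gaussWeight β (p * conjPoly p)).re
  convert h using 2 with x
  rw [eval_mul, eval_conjPoly, Complex.mul_conj, ← Complex.ofReal_mul]
  simp

theorem integral_normSq_nonneg (β : ℝ) (p : ℂ[X]) :
    0 ≤ ∫ x : ℝ, Complex.normSq (p.eval (x : ℂ)) * gaussWeight β x :=
  integral_nonneg fun x => mul_nonneg (Complex.normSq_nonneg _) (gaussWeight_pos β x).le

theorem eq_zero_of_integral_normSq (β : ℝ) (p : ℂ[X])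
    (h : ∫ x : ℝ, Complex.normSq (p.eval (x : ℂ)) * gaussWeight β x = 0) : p = 0 := by
  rw [integral_eq_zero_iff_of_nonneg
    (fun x => mul_nonneg (Complex.normSq_nonneg _) (gaussWeight_pos β x).le)
    (integrable_normSq_mul_gaussWeight β p)] at h
  have hc : Continuous fun x : ℝ => Complex.normSq (p.eval (x : ℂ)) * gaussWeight β x := by
    refine (Complex.continuous_normSq.comp (p.continuous.comp Complex.continuous_ofReal)).mul
      (continuous_gaussWeight β)
  have h0 := (hc.ae_eq_iff_eq volume continuous_const).mp h
  refine Polynomial.eq_zero_of_infinite_isRoot p ?_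
  refine Set.Infinite.mono ?_ (Set.infinite_range_of_injective Complex.ofReal_injective)
  rintro _ ⟨x, rfl⟩
  have hx : Complex.normSq (p.eval (x : ℂ)) * gaussWeight β x = 0 := congrFun h0 x
  exact Complex.normSq_eq_zero.mp
    ((mul_eq_zero.mp hx).resolve_right (gaussWeight_pos β x).ne')

/-- The total mass of the density `e^{-x^2+2βx}`. -/
def gaussMass (β : ℝ) : ℝ := ∫ x : ℝ, gaussWeight β x

theorem gaussInt_one (β : ℝ) : gaussInt β 1 = (gaussMass β : ℂ) := by
  rw [gaussInt_apply, gaussMass, ← integral_complex_ofReal]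
  simp

theorem gaussMass_pos (β : ℝ) : 0 < gaussMass β := by
  have h : gaussMass β = ∫ x : ℝ, Complex.normSq ((1 : ℂ[X]).eval (x : ℂ)) * gaussWeight β x := by
    simp [gaussMass]
  refine lt_of_le_of_ne (h ▸ integral_normSq_nonneg β 1) fun h0 => ?_
  exact one_ne_zero (eq_zero_of_integral_normSq β 1 (h.symm.trans h0.symm))

theorem gaussInt_one_ne_zero (β : ℝ) : gaussInt β 1 ≠ 0 := by
  rw [gaussInt_one]
  exact_mod_cast (gaussMass_pos β).ne'


/-! ### Hermite polynomials and Hermite coefficients. -/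

theorem derivative_raise (β : ℝ) (p : ℂ[X]) :
    derivative (raise β p) = raise β (derivative p) + p := by
  simp only [raise_apply, derivative_sub, derivative_mul, derivative_X, derivative_C,
    derivative_smul]
  ring

/-- The monic Hermite polynomials, orthogonal for the density `e^{-x^2+2βx}`. -/
def herm (β : ℝ) (n : ℕ) : ℂ[X] := (raise β ^ n) 1

theorem herm_zero (β : ℝ) : herm β 0 = 1 := rfl

theorem raise_herm (β : ℝ) (n : ℕ) : raise β (herm β n) = herm β (n + 1) := by
  rw [herm, herm, pow_succ', Module.End.mul_apply]

theorem derivative_herm_succ (β : ℝ) (n : ℕ) :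
    derivative (herm β (n + 1)) = (n + 1 : ℂ) • herm β n := by
  induction n with
  | zero => rw [← raise_herm, derivative_raise]; simp [herm_zero]
  | succ n ih =>
    rw [← raise_herm, derivative_raise, ih, map_smul, raise_herm]
    push_cast
    module

theorem derivative_herm_zero (β : ℝ) : derivative (herm β 0) = 0 := by simp [herm_zero]

theorem raise_derivative_herm (β : ℝ) (n : ℕ) :
    raise β (derivative (herm β n)) = (n : ℂ) • herm β n := by
  cases n with
  | zero => simp [derivative_herm_zero]
  | succ n => rw [derivative_herm_succ, map_smul, raise_herm]; push_cast; rfl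

theorem conjPoly_herm (β : ℝ) (n : ℕ) : conjPoly (herm β n) = herm β n := by
  induction n with
  | zero => simp [herm_zero, conjPoly]
  | succ n ih => rw [← raise_herm, conjPoly_raise, ih]

theorem natDegree_herm_le (β : ℝ) (n : ℕ) : (herm β n).natDegree ≤ n := by
  induction n with
  | zero => simp [herm_zero]
  | succ n ih =>
    rw [← raise_herm, raise_apply]
    refine (natDegree_sub_le _ _).trans (max_le ?_ ?_)
    · refine natDegree_mul_le.trans ?_
      rw [natDegree_X_sub_C]
      omega
    · exact (natDegree_smul_le _ _).trans ((natDegree_derivative_le _).trans (by omega))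

theorem coeff_herm_of_lt (β : ℝ) {n k : ℕ} (h : n < k) : (herm β n).coeff k = 0 :=
  coeff_eq_zero_of_natDegree_lt ((natDegree_herm_le β n).trans_lt h)

theorem coeff_herm_self (β : ℝ) (n : ℕ) : (herm β n).coeff n = 1 := by
  induction n with
  | zero => simp [herm_zero]
  | succ n ih =>
    rw [← raise_herm, raise_apply, sub_mul, coeff_sub, coeff_sub, coeff_X_mul, coeff_C_mul, ih,
      coeff_smul, coeff_derivative, coeff_herm_of_lt β (by omega : n < n + 1),
      coeff_herm_of_lt β (by omega : n < n + 1 + 1)]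
    simp

/-- Change of centre for the Hermite polynomials. -/
theorem herm_eq_sum (β γ : ℝ) (n : ℕ) :
    herm β n = ∑ j ∈ Finset.range (n + 1),
      ((n.choose j : ℂ) * ((γ : ℂ) - β) ^ (n - j)) • herm γ j := by
  -- Moving the centre changes the raising operator by a scalar, so its `n`-th power is given by the
  -- binomial theorem.
  have h : raise β = raise γ + algebraMap ℂ (Module.End ℂ ℂ[X]) ((γ : ℂ) - β) := by
    refine LinearMap.ext fun p => ?_
    simp only [LinearMap.add_apply, raise_apply, Module.algebraMap_end_apply, smul_eq_C_mul, C_sub]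
    ring
  have hcomm : Commute (raise γ) (algebraMap ℂ (Module.End ℂ ℂ[X]) ((γ : ℂ) - β)) :=
    (Algebra.commutes _ _).symm
  rw [herm, h, hcomm.add_pow, LinearMap.sum_apply]
  refine Finset.sum_congr rfl fun j _ => ?_
  rw [← map_pow, ← map_natCast (algebraMap ℂ (Module.End ℂ ℂ[X])), mul_assoc, ← map_mul,
    Module.End.mul_apply, Module.algebraMap_end_apply, map_smul, mul_comm]
  rfl

theorem gaussInt_herm_mul_herm (β : ℝ) (n m : ℕ) :
    gaussInt β (herm β n * herm β m) =
      if n = m then (n.factorial / 2 ^ n : ℂ) * gaussInt β 1 else 0 := by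
  induction n generalizing m with
  | zero =>
    rw [herm_zero, one_mul]
    cases m with
    | zero => simp [herm_zero]
    | succ m => rw [← raise_herm, gaussInt_raise]; simp
  | succ n ih =>
    rw [← raise_herm]
    have h := gaussInt_mul_derivative β (herm β n) (herm β m)
    cases m with
    | zero =>
      rw [derivative_herm_zero, mul_zero, map_zero] at h
      simpa using h.symm
    | succ m =>
      rw [derivative_herm_succ, mul_smul_comm, map_smul, ih, smul_eq_mul] at h
      have h2 : gaussInt β (raise β (herm β n) * herm β (m + 1)) =
          ((m + 1 : ℂ) * if n = m then (n.factorial / 2 ^ n : ℂ) * gaussInt β 1 else 0) / 2 := by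
        rw [h]; ring
      rw [h2]
      by_cases hnm : n = m
      · subst hnm
        simp only [if_true, Nat.factorial_succ, pow_succ]
        push_cast
        field_simp
      · simp [hnm]

/-- The coefficient of `herm β k` in the expansion in Hermite polynomials. -/
def hermCoeff (β : ℝ) (k : ℕ) : ℂ[X] →ₗ[ℂ] ℂ :=
  ((k.factorial : ℂ) * gaussInt β 1)⁻¹ •
    (gaussInt β ∘ₗ ((Polynomial.derivative : ℂ[X] →ₗ[ℂ] ℂ[X]) ^ k))

theorem hermCoeff_apply (β : ℝ) (k : ℕ) (p : ℂ[X]) :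
    hermCoeff β k p = ((k.factorial : ℂ) * gaussInt β 1)⁻¹ * gaussInt β (derivative^[k] p) := by
  rw [hermCoeff, LinearMap.smul_apply, LinearMap.comp_apply, Module.End.pow_apply, smul_eq_mul]

theorem hermCoeff_succ (β : ℝ) (k : ℕ) (p : ℂ[X]) :
    hermCoeff β (k + 1) p = (k + 1 : ℂ)⁻¹ * hermCoeff β k (derivative p) := by
  rw [hermCoeff_apply, hermCoeff_apply, Function.iterate_succ_apply, Nat.factorial_succ]
  push_cast
  rw [mul_assoc, mul_inv (k + 1 : ℂ), mul_assoc]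

/-- Differentiating `k` times sends `herm β n` to a multiple of `herm β (n - k)`, or to zero if `n <
k`; its mean vanishes unless `n = k`. -/
theorem hermCoeff_herm (β : ℝ) (k n : ℕ) :
    hermCoeff β k (herm β n) = if k = n then 1 else 0 := by
  induction k generalizing n with
  | zero =>
    rw [hermCoeff_apply]
    cases n with
    | zero => simp [herm_zero, gaussInt_one_ne_zero]
    | succ n => simp [← raise_herm, gaussInt_raise]
  | succ k ih =>
    rw [hermCoeff_succ]
    cases n with
    | zero => simp [derivative_herm_zero]
    | succ n =>
      rw [derivative_herm_succ, map_smul, ih]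
      by_cases h : k = n
      · subst h
        simp [Nat.cast_add_one_ne_zero k]
      · simp [h]

/-- The coefficient of index `p.natDegree` is the leading coefficient, because that derivative of
`p` is constant. -/
theorem eq_zero_of_hermCoeff (β : ℝ) (p : ℂ[X]) (h : ∀ k, hermCoeff β k p = 0) : p = 0 := by
  by_contra hp
  have hd := h p.natDegree
  have h1 : derivative^[p.natDegree] p = ((p.natDegree.factorial : ℂ) * p.leadingCoeff) • 1 := by
    have h0 : (derivative^[p.natDegree] p).natDegree ≤ 0 := by
      refine (natDegree_iterate_derivative p _).trans (by omega)
    rw [eq_C_of_natDegree_le_zero h0, coeff_iterate_derivative, zero_add, Nat.descFactorial_self,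
      smul_eq_C_mul, mul_one]
    simp
  rw [hermCoeff_apply, h1, map_smul, smul_eq_mul] at hd
  have := gaussInt_one_ne_zero β
  have hl : p.leadingCoeff ≠ 0 := leadingCoeff_ne_zero.mpr hp
  have hf : (p.natDegree.factorial : ℂ) ≠ 0 := by exact_mod_cast p.natDegree.factorial_ne_zero
  simp [this, hl, hf] at hd

theorem hermCoeff_ext (β : ℝ) {p q : ℂ[X]} (h : ∀ k, hermCoeff β k p = hermCoeff β k q) :
    p = q :=
  sub_eq_zero.mp (eq_zero_of_hermCoeff β _ fun k => by rw [map_sub, h, sub_self])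

/-! ### The Weyl algebra in Hermite bases. -/

/-- The Weyl algebra of scalar differential operators with polynomial coefficients. -/
def weyl : Subalgebra ℂ (Module.End ℂ ℂ[X]) :=
  Algebra.adjoin ℂ {LinearMap.mulLeft ℂ (X : ℂ[X]), Polynomial.derivative}

theorem mulX_mem_weyl : LinearMap.mulLeft ℂ (X : ℂ[X]) ∈ weyl :=
  Algebra.subset_adjoin (by simp)

theorem derivative_mem_weyl : (Polynomial.derivative : Module.End ℂ ℂ[X]) ∈ weyl :=
  Algebra.subset_adjoin (by simp)

theorem mulLeft_mem_weyl (f : ℂ[X]) : LinearMap.mulLeft ℂ f ∈ weyl := by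
  induction f using Polynomial.induction_on' with
  | add p q hp hq =>
    have : LinearMap.mulLeft ℂ (p + q) = LinearMap.mulLeft ℂ p + LinearMap.mulLeft ℂ q := by
      exact LinearMap.ext fun r => by simp [add_mul]
    rw [this]
    exact add_mem hp hq
  | monomial n a =>
    have : LinearMap.mulLeft ℂ (monomial n a) = a • LinearMap.mulLeft ℂ (X : ℂ[X]) ^ n := by
      rw [LinearMap.pow_mulLeft]
      refine LinearMap.ext fun r => ?_
      rw [LinearMap.smul_apply, LinearMap.mulLeft_apply, LinearMap.mulLeft_apply,
        ← C_mul_X_pow_eq_monomial, smul_eq_C_mul, mul_assoc]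
    rw [this]
    exact Subalgebra.smul_mem _ (pow_mem mulX_mem_weyl n) a

/-- The matrix of `F` in the Hermite basis has finitely many nonzero subdiagonals on one side, and
each of its diagonals is given by a polynomial. -/
def HermiteBanded (β : ℝ) (F : Module.End ℂ ℂ[X]) : Prop :=
  ∃ (p : ℤ → ℂ[X]) (M : ℕ),
    (∀ n k : ℕ, hermCoeff β k (F (herm β n)) = (p (k - n)).eval (n : ℂ)) ∧
    ∀ n k : ℕ, k + M < n → hermCoeff β k (F (herm β n)) = 0

theorem hermiteBanded_one (β : ℝ) : HermiteBanded β 1 := by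
  refine ⟨fun i => if i = 0 then 1 else 0, 0, fun n k => ?_, fun n k h => ?_⟩
  · rw [Module.End.one_apply, hermCoeff_herm]
    by_cases h : k = n
    · simp [h]
    · have : (k : ℤ) - n ≠ 0 := by omega
      simp [h, this]
  · rw [Module.End.one_apply, hermCoeff_herm, if_neg (by omega)]

theorem HermiteBanded.add {β : ℝ} {F G : Module.End ℂ ℂ[X]} (hF : HermiteBanded β F)
    (hG : HermiteBanded β G) : HermiteBanded β (F + G) := by
  obtain ⟨p, M, hp, hM⟩ := hF
  obtain ⟨q, N, hq, hN⟩ := hG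
  refine ⟨p + q, M + N, fun n k => ?_, fun n k h => ?_⟩
  · simp [hp, hq]
  · simp [hM n k (by omega), hN n k (by omega)]

theorem HermiteBanded.smul {β : ℝ} {F : Module.End ℂ ℂ[X]} (hF : HermiteBanded β F) (r : ℂ) :
    HermiteBanded β (r • F) := by
  obtain ⟨p, M, hp, hM⟩ := hF
  refine ⟨r • p, M, fun n k => ?_, fun n k h => ?_⟩
  · simp [hp]
  · simp [hM n k h]

theorem HermiteBanded.mul_raise {β : ℝ} {F : Module.End ℂ ℂ[X]} (hF : HermiteBanded β F) :
    HermiteBanded β (F * raise β) := by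
  obtain ⟨p, M, hp, hM⟩ := hF
  refine ⟨fun i => (p (i - 1)).comp (X + 1), M, fun n k => ?_, fun n k h => ?_⟩
  · rw [Module.End.mul_apply, raise_herm, hp]
    simp [sub_sub]
  · rw [Module.End.mul_apply, raise_herm, hM _ _ (by omega)]

theorem HermiteBanded.mul_derivative {β : ℝ} {F : Module.End ℂ ℂ[X]} (hF : HermiteBanded β F) :
    HermiteBanded β (F * Polynomial.derivative) := by
  obtain ⟨p, M, hp, hM⟩ := hF
  -- The factor `X` is the `n` in `H_n' = n H_{n-1}`; it also covers `n = 0`, where no shift is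
  -- available.
  refine ⟨fun i => X * (p (i + 1)).comp (X - 1), M + 1, fun n k => ?_, fun n k h => ?_⟩
  · rw [Module.End.mul_apply]
    cases n with
    | zero => simp [derivative_herm_zero]
    | succ n =>
      rw [derivative_herm_succ, map_smul, map_smul, hp]
      have : (k : ℤ) - (n + 1) + 1 = k - n := by ring
      simp [this]
  · rw [Module.End.mul_apply]
    cases n with
    | zero => simp [derivative_herm_zero]
    | succ n => rw [derivative_herm_succ, map_smul, map_smul, hM _ _ (by omega), smul_zero]

theorem hermiteBanded_of_mem_weyl (β : ℝ) {G : Module.End ℂ ℂ[X]} (hG : G ∈ weyl) :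
    HermiteBanded β G := by
  -- Quantifying over a left factor makes the induction multiplicative: only right multiplication by
  -- generators has to be checked, and there the raising operator and the derivative just shift the
  -- index.
  suffices h : ∀ F : Module.End ℂ ℂ[X], HermiteBanded β F → HermiteBanded β (F * G) by
    simpa using h 1 (hermiteBanded_one β)
  unfold weyl at hG
  induction hG using Algebra.adjoin_induction with
  | mem G h =>
    intro F hF
    rcases h with rfl | rfl
    · have : F * LinearMap.mulLeft ℂ (X : ℂ[X]) =
          F * raise β + (1 / 2 : ℂ) • (F * Polynomial.derivative) + (β : ℂ) • F := by
        refine LinearMap.ext fun p => ?_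
        have hX : (X : ℂ[X]) * p =
            raise β p + (1 / 2 : ℂ) • derivative p + (β : ℂ) • p := by
          rw [raise_apply, smul_eq_C_mul, smul_eq_C_mul]
          ring
        simp only [Module.End.mul_apply, LinearMap.mulLeft_apply, LinearMap.add_apply,
          LinearMap.smul_apply, hX, map_add, map_smul]
      rw [this]
      exact (hF.mul_raise.add (hF.mul_derivative.smul _)).add (hF.smul _)
    · exact hF.mul_derivative
  | algebraMap r =>
    intro F hF
    rw [Algebra.algebraMap_eq_smul_one, mul_smul_comm, mul_one]
    exact hF.smul r
  | add G G' _ _ h h' =>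
    intro F hF
    rw [mul_add]
    exact (h F hF).add (h' F hF)
  | mul G G' _ _ h h' =>
    intro F hF
    rw [← mul_assoc]
    exact h' _ (h F hF)

theorem exists_eval_eq_hermCoeff (β : ℝ) {F : Module.End ℂ ℂ[X]} (hF : F ∈ weyl) :
    ∃ P : ℂ[X], ∀ n : ℕ, hermCoeff β n (F (herm β n)) = P.eval (n : ℂ) := by
  obtain ⟨p, M, hp, -⟩ := hermiteBanded_of_mem_weyl β hF
  exact ⟨p 0, fun n => by simpa using hp n n⟩

theorem X_mul_mem_span_herm (β : ℝ) (p : ℂ[X])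
    (hp : p ∈ Submodule.span ℂ (Set.range (herm β))) :
    X * p ∈ Submodule.span ℂ (Set.range (herm β)) := by
  have hmem : ∀ n, herm β n ∈ Submodule.span ℂ (Set.range (herm β)) := fun n =>
    Submodule.subset_span ⟨n, rfl⟩
  induction hp using Submodule.span_induction with
  | mem q h =>
    obtain ⟨n, rfl⟩ := h
    have hX : (X : ℂ[X]) * herm β n =
        herm β (n + 1) + (1 / 2 : ℂ) • derivative (herm β n) + (β : ℂ) • herm β n := by
      rw [← raise_herm, raise_apply, smul_eq_C_mul, smul_eq_C_mul]
      ring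
    rw [hX]
    refine add_mem (add_mem (hmem _) (Submodule.smul_mem _ _ ?_)) (Submodule.smul_mem _ _ (hmem _))
    cases n with
    | zero => simp [derivative_herm_zero]
    | succ n => rw [derivative_herm_succ]; exact Submodule.smul_mem _ _ (hmem _)
  | zero => simp
  | add q r _ _ hq hr => rw [mul_add]; exact add_mem hq hr
  | smul s q _ hq => rw [mul_smul_comm]; exact Submodule.smul_mem _ _ hq

theorem span_herm (β : ℝ) : Submodule.span ℂ (Set.range (herm β)) = ⊤ := by
  refine Submodule.eq_top_iff'.mpr fun p => ?_
  induction p using Polynomial.induction_on' with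
  | add p q hp hq => exact add_mem hp hq
  | monomial n a =>
    rw [← C_mul_X_pow_eq_monomial, ← smul_eq_C_mul]
    refine Submodule.smul_mem _ _ ?_
    induction n with
    | zero => exact Submodule.subset_span ⟨0, by simp [herm_zero]⟩
    | succ n ih => rw [pow_succ']; exact X_mul_mem_span_herm β _ ih

theorem eq_zero_of_herm (β : ℝ) {F : Module.End ℂ ℂ[X]} (h : ∀ n, F (herm β n) = 0) : F = 0 :=
  LinearMap.ext_on_range (span_herm β) fun n => by simp [h]

/-- Each diagonal is a polynomial in `n` with infinitely many zeros. This is what allows the low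
indices to be ignored later. -/
theorem eq_zero_of_eventually_herm (β : ℝ) {F : Module.End ℂ ℂ[X]} (hF : F ∈ weyl) (N : ℕ)
    (h : ∀ n ≥ N, F (herm β n) = 0) : F = 0 := by
  obtain ⟨p, M, hp, -⟩ := hermiteBanded_of_mem_weyl β hF
  have hz : ∀ i : ℤ, p i = 0 := by
    intro i
    refine Polynomial.eq_zero_of_infinite_isRoot _ ?_
    refine Set.Infinite.mono ?_ (Set.infinite_range_of_injective
      (fun (a b : ℕ) (hab : ((a + N + i.natAbs : ℕ) : ℂ) = ((b + N + i.natAbs : ℕ) : ℂ)) => by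
        have := Nat.cast_injective hab
        omega))
    rintro _ ⟨n, rfl⟩
    -- Adding `i.natAbs` keeps the row index nonnegative, so `toNat` loses nothing.
    have h1 := hp (n + N + i.natAbs) (n + N + i.natAbs + i).toNat
    rw [h _ (by omega), map_zero] at h1
    have h2 : (((n : ℤ) + N + i.natAbs + i).toNat : ℤ) - ((n + N + i.natAbs : ℕ) : ℤ) = i := by
      omega
    rw [h2] at h1
    exact h1.symm
  refine eq_zero_of_herm β fun n => eq_zero_of_hermCoeff β _ fun k => ?_
  rw [hp, hz, eval_zero]

/-- By Pascal's rule, differencing in `n` turns the relation into one with one term fewer. -/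
theorem eq_zero_of_sum_choose (N A : ℕ) (c : ℕ → ℂ)
    (h : ∀ n ≥ N, ∑ j ∈ Finset.range A, (n.choose j : ℂ) * c j = 0) : ∀ j < A, c j = 0 := by
  induction A generalizing c with
  | zero => intro j hj; omega
  | succ A ih =>
    have h1 : ∀ j < A, c (j + 1) = 0 := by
      refine ih (fun j => c (j + 1)) fun n hn => ?_
      have e1 := h n hn
      have e2 := h (n + 1) (by omega)
      rw [Finset.sum_range_succ'] at e1 e2
      simp only [Nat.choose_succ_succ', Nat.cast_add, add_mul, Finset.sum_add_distrib,
        Nat.choose_zero_right] at e1 e2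
      linear_combination e2 - e1
    intro j hj
    cases j with
    | zero =>
      have e := h N le_rfl
      rw [Finset.sum_range_succ', Finset.sum_eq_zero] at e
      · simpa using e
      · intro i hi
        rw [h1 i (Finset.mem_range.mp hi), mul_zero]
    | succ j => exact h1 j (by omega)

/-- A differential operator with polynomial coefficients that is banded between Hermite bases with
different centres vanishes. -/
theorem eq_zero_of_banded_of_ne {β γ : ℝ} (hne : β ≠ γ) {F : Module.End ℂ ℂ[X]} (hF : F ∈ weyl)
    (h : ∀ k, ∃ N, ∀ n ≥ N, hermCoeff γ k (F (herm β n)) = 0) : F = 0 := by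
  obtain ⟨p, M, -, hM⟩ := hermiteBanded_of_mem_weyl γ hF
  have hs : ((γ : ℂ) - β) ≠ 0 := by
    rw [sub_ne_zero]
    exact_mod_cast hne.symm
  refine eq_zero_of_herm γ fun j => eq_zero_of_hermCoeff γ _ fun k => ?_
  obtain ⟨N, hN⟩ := h k
  -- Only `j ≤ k + M` contribute to coefficient `k`, since `F` is banded for `γ`. Once `(γ - β)^n`
  -- is factored out, a relation between binomials in `n` remains, valid for all large `n`.
  have key := eq_zero_of_sum_choose (N + (k + M + 1)) (k + M + 1)
    (fun j => (((γ : ℂ) - β) ^ j)⁻¹ * hermCoeff γ k (F (herm γ j))) fun n hn => by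
      have e := hN n (by omega)
      rw [herm_eq_sum β γ n] at e
      simp only [map_sum, map_smul, smul_eq_mul] at e
      rw [← Finset.sum_subset (Finset.range_mono (by omega : k + M + 1 ≤ n + 1))] at e
      · have e' : ((γ : ℂ) - β) ^ n * ∑ j ∈ Finset.range (k + M + 1), (n.choose j : ℂ) *
            ((((γ : ℂ) - β) ^ j)⁻¹ * hermCoeff γ k (F (herm γ j))) = 0 := by
          rw [← e, Finset.mul_sum]
          refine Finset.sum_congr rfl fun i hi => ?_
          have hi' : i ≤ n := by have := Finset.mem_range.mp hi; omega
          rw [← pow_sub_mul_pow _ hi']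
          field_simp
        exact (mul_eq_zero.mp e').resolve_left (pow_ne_zero _ hs)
      · intro i _ hi
        rw [hM i k (by simpa using hi), mul_zero]
  by_cases hj : j < k + M + 1
  · exact (mul_eq_zero.mp (key j hj)).resolve_left (inv_ne_zero (pow_ne_zero _ hs))
  · exact hM j k (by omega)


/-! ### Factorization of the weight, conjugation by the unipotent factor, and symmetry. -/

/-- The unipotent factor `T` in `W = T diag(e^{-x^2+2bx}, e^{-x^2}, e^{-x^2}) T^*`. -/
def unipotent (a c : ℝ) : MatPoly 3 :=
  !![1, cst a * X, 0; 0, 1, 0; 0, cst c * X, 1]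

/-- The inverse of `unipotent a c`. -/
def unipotentInv (a c : ℝ) : MatPoly 3 :=
  !![1, -(cst a * X), 0; 0, 1, 0; 0, -(cst c * X), 1]

theorem unipotent_mul_inv (a c : ℝ) : unipotent a c * unipotentInv a c = 1 := by
  ext1 i j
  fin_cases i <;> fin_cases j <;>
    simp [unipotent, unipotentInv, Matrix.mul_apply, Fin.sum_univ_three]

theorem unipotentInv_mul (a c : ℝ) : unipotentInv a c * unipotent a c = 1 := by
  ext1 i j
  fin_cases i <;> fin_cases j <;>
    simp [unipotent, unipotentInv, Matrix.mul_apply, Fin.sum_univ_three]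

theorem mul_unipotentInv_mul (a c : ℝ) (P : MatPoly 3) :
    P * unipotentInv a c * unipotent a c = P := by
  rw [mul_assoc, unipotentInv_mul, mul_one]

theorem mul_unipotent_mul_inv (a c : ℝ) (P : MatPoly 3) :
    P * unipotent a c * unipotentInv a c = P := by
  rw [mul_assoc, unipotent_mul_inv, mul_one]

theorem evalAt_mul {N : ℕ} (P Q : MatPoly N) (x : ℝ) :
    evalAt (P * Q) x = evalAt P x * evalAt Q x := by
  ext1 i j
  simp [evalAt, Matrix.mul_apply, eval_finsetSum]

/-- The centres of the three diagonal densities. -/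
def centre (b : ℝ) : Fin 3 → ℝ := ![b, 0, 0]

theorem hermiteWeight_eq (a b c x : ℝ) :
    hermiteWeight a b c x = evalAt (unipotent a c) x *
      Matrix.diagonal (fun k => (gaussWeight (centre b k) x : ℂ)) *
        (evalAt (unipotent a c) x).conjTranspose := by
  ext1 i j
  fin_cases i <;> fin_cases j <;>
    simp [hermiteWeight, evalAt, unipotent, centre, gaussWeight, cst, Matrix.mul_apply,
      Fin.sum_univ_three, Matrix.diagonal_apply] <;> ring

theorem form_hermiteWeight (a b c : ℝ) (P Q : MatPoly 3) (i j : Fin 3) :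
    form (hermiteWeight a b c) P Q i j = ∑ k, gaussInt (centre b k)
      ((P * unipotent a c) i k * conjPoly ((Q * unipotent a c) j k)) := by
  simp only [gaussInt_apply, form, Matrix.of_apply]
  rw [← integral_finsetSum _ fun k _ => integrable_eval_mul_gaussWeight _ _]
  congr 1
  ext x
  have h : evalAt P x * hermiteWeight a b c x * (evalAt Q x).conjTranspose =
      evalAt (P * unipotent a c) x *
        Matrix.diagonal (fun k => (gaussWeight (centre b k) x : ℂ)) *
          (evalAt (Q * unipotent a c) x).conjTranspose := by
    rw [hermiteWeight_eq, evalAt_mul, evalAt_mul, Matrix.conjTranspose_mul]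
    simp only [mul_assoc]
  rw [h, Matrix.mul_apply]
  refine Finset.sum_congr rfl fun k _ => ?_
  rw [Matrix.mul_diagonal, Matrix.conjTranspose_apply, eval_mul, eval_conjPoly]
  simp only [evalAt, Matrix.map_apply, RCLike.star_def]
  ring

theorem act_coefOp {N : ℕ} (P F : MatPoly N) : act P (coefOp F) = P * F := rfl

theorem act_partialOp {N : ℕ} (P : MatPoly N) :
    act P (partialOp N) = P.map fun p => derivative p := rfl

theorem act_add {N : ℕ} (P : MatPoly N) (D E : RightOp N) :
    act P (D + E) = act P D + act P E := rfl

theorem act_mul {N : ℕ} (P : MatPoly N) (D E : RightOp N) :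
    act P (D * E) = act (act P D) E := rfl

/-- The operator `D₁` after conjugation by `unipotent a c`. -/
def diagOp₁ (b : ℝ) (Y : MatPoly 3) : MatPoly 3 :=
  Matrix.of fun k =>
    ![(-2 : ℂ) • raise b (derivative (Y k 0)),
      (-2 : ℂ) • raise 0 (derivative (Y k 1)) + (2 : ℂ) • Y k 1,
      (-2 : ℂ) • raise 0 (derivative (Y k 2))]

/-- The operator `D₂` after conjugation by `unipotent a c`. -/
def diagOp₂ (c : ℝ) (Y : MatPoly 3) : MatPoly 3 :=
  Matrix.of fun k =>
    ![((2 + 4 / c ^ 2 : ℝ) : ℂ) • Y k 0,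
      ((2 + 4 / c ^ 2 : ℝ) : ℂ) • Y k 1 + (-2 : ℂ) • raise 0 (derivative (Y k 1)) +
        ((-(4 / c) : ℝ) : ℂ) • raise 0 (Y k 2),
      ((-(2 / c) : ℝ) : ℂ) • derivative (Y k 1) + (2 : ℂ) • Y k 2]

theorem act_opD₁_mul_unipotent (a b c : ℝ) (P : MatPoly 3) :
    act P (opD₁ a b c) * unipotent a c = diagOp₁ b (P * unipotent a c) := by
  rw [opD₁, act_add, act_add, act_mul _ (partialOp 3) (coefOp _), pow_two, act_mul,
    act_coefOp, act_coefOp, act_partialOp, act_partialOp]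
  have hh : (C 2⁻¹ * 2 : ℂ[X]) = 1 := by
    rw [← C_ofNat, ← C_mul]; norm_num
  have h2 : (C 2 : ℂ[X]) = 2 := map_ofNat C 2
  ext1 k j
  fin_cases j <;>
    simp [diagOp₁, unipotent, Matrix.mul_apply, Fin.sum_univ_three, raise_apply, cst,
      smul_eq_C_mul, h2]
  · linear_combination (-derivative (derivative (P k 0))) * hh
  · linear_combination (-(C (a : ℂ) *
      (X * derivative (derivative (P k 0)) + 2 * derivative (P k 0)) +
      derivative (derivative (P k 1)) +
      C (c : ℂ) * (X * derivative (derivative (P k 2)) + 2 * derivative (P k 2)))) * hh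
  · linear_combination (-derivative (derivative (P k 2))) * hh

theorem act_opD₂_mul_unipotent (a c : ℝ) (hc : c ≠ 0) (P : MatPoly 3) :
    act P (opD₂ a c) * unipotent a c = diagOp₂ c (P * unipotent a c) := by
  rw [opD₂, act_add, act_add, act_mul _ (partialOp 3) (coefOp _), pow_two, act_mul, act_mul,
    act_coefOp, act_coefOp, act_coefOp, act_partialOp, act_partialOp]
  have hh : (C 2⁻¹ * 2 : ℂ[X]) = 1 := by
    rw [← C_ofNat, ← C_mul]; norm_num
  have h2 : (C 2 : ℂ[X]) = 2 := map_ofNat C 2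
  have h4 : (C 4 : ℂ[X]) = 4 := map_ofNat C 4
  have hc' : (C (c : ℂ) * C (c : ℂ)⁻¹ : ℂ[X]) = 1 := by
    rw [← C_mul, mul_inv_cancel₀ (by exact_mod_cast hc), C_1]
  ext1 k j
  fin_cases j <;>
    simp [diagOp₂, unipotent, Matrix.mul_apply, Fin.sum_univ_three, raise_apply, cst,
      smul_eq_C_mul, div_eq_mul_inv, h2, h4, ← inv_pow]
  · ring
  · linear_combination (-(C (a : ℂ) *
      (X * derivative (derivative (P k 0)) + 2 * derivative (P k 0)) +
      derivative (derivative (P k 1)) +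
      C (c : ℂ) * (X * derivative (derivative (P k 2)) + 2 * derivative (P k 2))) -
      2 * C (c : ℂ)⁻¹ * derivative (P k 2)) * hh +
      (-2 * C (a : ℂ) * X ^ 2 * derivative (P k 0) - 2 * X * derivative (P k 1) -
        2 * C (a : ℂ) * X * P k 0 - 4 * C (c : ℂ)⁻¹ * X * P k 2) * hc'
  · linear_combination (2 * X * derivative (P k 2) + 2 * P k 2) * hc'

theorem gaussInt_raise_derivative_mul (β : ℝ) (p q : ℂ[X]) :
    gaussInt β (raise β (derivative p) * q) = gaussInt β (p * raise β (derivative q)) := by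
  have h1 := gaussInt_mul_derivative β (derivative p) q
  have h2 := gaussInt_derivative_mul β p (derivative q)
  linear_combination (1 / 2) * h2 - (1 / 2) * h1

theorem isSymmetricOp_of_conj (a b c : ℝ) {D : RightOp 3} (E : MatPoly 3 → MatPoly 3)
    (hE : ∀ P, act P D * unipotent a c = E (P * unipotent a c))
    (h : ∀ (Y Z : MatPoly 3) (i j : Fin 3),
      ∑ k, gaussInt (centre b k) (E Y i k * conjPoly (Z j k)) =
        ∑ k, gaussInt (centre b k) (Y i k * conjPoly (E Z j k))) :
    IsSymmetricOp (hermiteWeight a b c) D := by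
  intro P Q
  ext1 i j
  rw [form_hermiteWeight, form_hermiteWeight, hE, hE, h]

theorem conjPoly_neg (p : ℂ[X]) : conjPoly (-p) = -conjPoly p := by
  simp [conjPoly]

theorem isSymmetricOp_opD₁ (a b c : ℝ) :
    IsSymmetricOp (hermiteWeight a b c) (opD₁ a b c) := by
  refine isSymmetricOp_of_conj a b c (diagOp₁ b) (act_opD₁_mul_unipotent a b c) fun Y Z i j => ?_
  simp [-Complex.coe_smul, Fin.sum_univ_three, diagOp₁, centre, conjPoly_neg,
    map_ofNat (starRingEnd ℂ), add_mul, mul_add, conjPoly_smul, conjPoly_add,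
    conjPoly_raise, conjPoly_derivative, gaussInt_raise_derivative_mul]

/-- The adjoint of the derivative is twice the raising operator, which matches the off-diagonal
coefficients `-2/c` and `-4/c` of `diagOp₂`. -/
theorem isSymmetricOp_opD₂ (a b c : ℝ) (hc : c ≠ 0) :
    IsSymmetricOp (hermiteWeight a b c) (opD₂ a c) := by
  refine isSymmetricOp_of_conj a b c (diagOp₂ c) (act_opD₂_mul_unipotent a c hc) fun Y Z i j => ?_
  simp [-Complex.coe_smul, Fin.sum_univ_three, diagOp₂, centre, conjPoly_neg,
    map_ofNat (starRingEnd ℂ), add_mul, mul_add, conjPoly_smul, conjPoly_add,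
    conjPoly_raise, conjPoly_derivative, gaussInt_raise_derivative_mul,
    gaussInt_derivative_mul, gaussInt_mul_derivative]
  ring

/-! ### An explicit orthogonal sequence. -/

/-- The ratio of the masses of `e^{-x^2}` and `e^{-x^2+2bx}`. -/
def massRatio (b : ℝ) : ℝ := gaussMass 0 / gaussMass b

theorem massRatio_pos (b : ℝ) : 0 < massRatio b := div_pos (gaussMass_pos 0) (gaussMass_pos b)

theorem gaussInt_zero_herm_mul_herm (b : ℝ) (n m : ℕ) :
    gaussInt 0 (herm 0 n * herm 0 m) =
      (massRatio b : ℂ) * gaussInt b (herm b n * herm b m) := by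
  have h : (gaussMass b : ℂ) ≠ 0 := by exact_mod_cast (gaussMass_pos b).ne'
  rw [gaussInt_herm_mul_herm, gaussInt_herm_mul_herm, gaussInt_one, gaussInt_one, massRatio]
  split_ifs
  · push_cast
    field_simp
  · simp

/-- The orthogonal polynomials for `hermiteWeight`, multiplied by `unipotent a c`. -/
def hermSeqConj (a b c : ℝ) (n : ℕ) : MatPoly 3 :=
  !![herm b n, (a : ℂ) • herm 0 (n + 1), 0;
     ((-(a * massRatio b / 2) : ℝ) : ℂ) • derivative (herm b n), herm 0 n,
       ((-(c / 2) : ℝ) : ℂ) • derivative (herm 0 n);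
     0, (c : ℂ) • herm 0 (n + 1), herm 0 n]

/-- A sequence of orthogonal polynomials for `hermiteWeight`. -/
def hermSeq (a b c : ℝ) (n : ℕ) : MatPoly 3 := hermSeqConj a b c n * unipotentInv a c

theorem hermSeq_mul_unipotent (a b c : ℝ) (n : ℕ) :
    hermSeq a b c n * unipotent a c = hermSeqConj a b c n :=
  mul_unipotentInv_mul a c _

/-- The only products not zero termwise pair row 1 with row 0 or row 2, for adjacent indices. There
integration by parts cancels the two contributions; `massRatio` compensates for the different masses
in the pairing with row 0. -/
theorem form_hermSeq_of_ne (a b c : ℝ) {n m : ℕ} (hnm : n ≠ m) :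
    form (hermiteWeight a b c) (hermSeq a b c n) (hermSeq a b c m) = 0 := by
  have o : ∀ β, gaussInt β (herm β n * herm β m) = 0 := fun β => by
    rw [gaussInt_herm_mul_herm, if_neg hnm]
  have o' : ∀ β, gaussInt β (herm β (n + 1) * herm β (m + 1)) = 0 := fun β => by
    rw [gaussInt_herm_mul_herm, if_neg (by omega)]
  have d : ∀ β, gaussInt β (herm β n * derivative (herm β m)) =
      2 * gaussInt β (herm β (n + 1) * herm β m) := fun β => by
    rw [gaussInt_mul_derivative, raise_herm]
  have d' : ∀ β, gaussInt β (derivative (herm β n) * herm β m) =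
      2 * gaussInt β (herm β n * herm β (m + 1)) := fun β => by
    rw [gaussInt_derivative_mul, raise_herm]
  have dd : ∀ β, gaussInt β (derivative (herm β n) * derivative (herm β m)) = 0 := fun β => by
    rw [gaussInt_derivative_mul, raise_derivative_herm, mul_smul_comm, map_smul, o]
    simp
  have r := gaussInt_zero_herm_mul_herm b (n + 1) m
  have r' := gaussInt_zero_herm_mul_herm b n (m + 1)
  ext1 i j
  rw [form_hermiteWeight, hermSeq_mul_unipotent, hermSeq_mul_unipotent, Fin.sum_univ_three]
  have z : conjPoly 0 = 0 := by simp [conjPoly]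
  fin_cases i <;> fin_cases j <;>
    simp [-Complex.coe_smul, hermSeqConj, centre, conjPoly_neg,
      map_ofNat (starRingEnd ℂ), conjPoly_smul, conjPoly_herm, conjPoly_derivative, o, o', d, d',
      dd, r, r', z] <;> ring

/-- Multiplication by `T⁻¹` produces differences such as `a H_{n+1} - a x H_n`, whose terms of
degree `n + 1` cancel because all Hermite polynomials are monic. -/
theorem coeffMat_hermSeq_of_lt (a b c : ℝ) {n k : ℕ} (h : n < k) :
    coeffMat (hermSeq a b c n) k = 0 := by
  obtain ⟨k, rfl⟩ : ∃ m, k = m + 1 := ⟨k - 1, by omega⟩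
  have h0 : ∀ β, (herm β n).coeff (k + 1) = 0 := fun β => coeff_herm_of_lt β h
  have h1 : ∀ β, (derivative (herm β n)).coeff k = 0 := fun β => by
    rw [coeff_derivative, h0, zero_mul]
  have h1' : ∀ β, (derivative (herm β n)).coeff (k + 1) = 0 := fun β => by
    rw [coeff_derivative, coeff_herm_of_lt β (by omega), zero_mul]
  have h2 : (herm 0 (n + 1)).coeff (k + 1) = (herm 0 n).coeff k := by
    rw [← raise_herm, raise_apply, sub_mul]
    simp [coeff_X_mul, h1']
  have h3 : (herm 0 n).coeff k = (herm b n).coeff k := by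
    rcases eq_or_lt_of_le (Nat.lt_succ_iff.mp h) with rfl | h'
    · rw [coeff_herm_self, coeff_herm_self]
    · rw [coeff_herm_of_lt _ h', coeff_herm_of_lt _ h']
  ext1 i j
  fin_cases i <;> fin_cases j <;>
    simp [coeffMat, hermSeq, hermSeqConj, unipotentInv,
      cst, h0, h1, h1', h2, h3, ← mul_assoc, coeff_mul_X]
  all_goals ring

/-- The determinant is `1 + (n/2)(a² massRatio b + c²)`, which is positive. -/
theorem det_coeffMat_hermSeq (a b c : ℝ) (n : ℕ) : (coeffMat (hermSeq a b c n) n).det ≠ 0 := by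
  have h1 : ∀ β, (derivative (herm β n)).coeff n = 0 := fun β => by
    rw [coeff_derivative, coeff_herm_of_lt β (by omega), zero_mul]
  have h2 : ∀ (β : ℝ) (r : ℂ), (derivative (herm β n) * (C r * X)).coeff n = n * r := fun β r => by
    cases n with
    | zero => simp [derivative_herm_zero]
    | succ n =>
      rw [← mul_assoc, coeff_mul_X, coeff_mul_C, coeff_derivative, coeff_herm_self]
      push_cast
      ring
  have h3 : (0 : ℝ) < 1 + n / 2 * (a ^ 2 * massRatio b + c ^ 2) := by
    have := (massRatio_pos b).le
    positivity
  have h4 : (coeffMat (hermSeq a b c n) n).det =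
      ((1 + n / 2 * (a ^ 2 * massRatio b + c ^ 2) : ℝ) : ℂ) := by
    rw [Matrix.det_fin_three]
    simp [coeffMat, hermSeq, hermSeqConj, unipotentInv,
      cst, h1, h2, coeff_herm_self]
    ring
  rw [h4]
  exact_mod_cast h3.ne'

theorem isOrthogonalSequence_hermSeq (a b c : ℝ) :
    IsOrthogonalSequence (hermiteWeight a b c) (hermSeq a b c) where
  degree_le _ _ h := coeffMat_hermSeq_of_lt a b c h
  leading := det_coeffMat_hermSeq a b c
  orthogonal _ _ h := form_hermSeq_of_ne a b c h


/-! ### Uniqueness of orthogonal sequences up to constant factors. -/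

theorem coeffMat_constMat_mul {N : ℕ} (M : Matrix (Fin N) (Fin N) ℂ) (P : MatPoly N) (k : ℕ) :
    coeffMat (constMat M * P) k = M * coeffMat P k := by
  ext1 i j
  simp [coeffMat, constMat, Matrix.mul_apply]

theorem coeffMat_sub {N : ℕ} (P Q : MatPoly N) (k : ℕ) :
    coeffMat (P - Q) k = coeffMat P k - coeffMat Q k := by
  ext1 i j
  simp [coeffMat]

theorem constMat_mul {N : ℕ} (M L : Matrix (Fin N) (Fin N) ℂ) :
    constMat (M * L) = constMat M * constMat L := by
  simp [constMat, Matrix.map_mul]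

theorem constMat_mul_apply {N : ℕ} (M : Matrix (Fin N) (Fin N) ℂ) (P : MatPoly N) (i j : Fin N) :
    (constMat M * P) i j = ∑ l, M i l • P l j := by
  simp [constMat, Matrix.mul_apply, smul_eq_C_mul]

/-- A sequence with `Q_n` of degree `n` with nonsingular leading coefficient generates the matrix
polynomials as a left module over the constant matrices, compatibly with degrees. -/
theorem induction_of_leading {N : ℕ} {Q : ℕ → MatPoly N}
    (hdeg : ∀ n k : ℕ, n < k → coeffMat (Q n) k = 0)
    (hlead : ∀ n : ℕ, (coeffMat (Q n) n).det ≠ 0) (p : MatPoly N → Prop) (h0 : p 0)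
    (hadd : ∀ P R, p P → p R → p (P + R)) (n : ℕ)
    (hQ : ∀ k < n, ∀ M, p (constMat M * Q k)) (S : MatPoly N)
    (hS : ∀ k ≥ n, coeffMat S k = 0) : p S := by
  induction n generalizing S with
  | zero =>
    have : S = 0 := by
      ext1 i j
      ext1 k
      exact congrFun (congrFun (hS k (Nat.zero_le k)) i) j
    rwa [this]
  | succ n ih =>
    set M := coeffMat S n * (coeffMat (Q n) n)⁻¹ with hM
    have h1 : p (S - constMat M * Q n) := by
      refine ih (fun k hk => hQ k (by omega)) _ fun k hk => ?_
      rw [coeffMat_sub, coeffMat_constMat_mul]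
      rcases eq_or_lt_of_le hk with rfl | hk
      · rw [hM, mul_assoc, Matrix.nonsing_inv_mul _ (hlead n).isUnit, mul_one, sub_self]
      · rw [hS k hk, hdeg n k hk, mul_zero, sub_zero]
    have h2 := hadd _ _ h1 (hQ n (by omega) M)
    rwa [sub_add_cancel] at h2

theorem form_sub_left (a b c : ℝ) (P R S : MatPoly 3) :
    form (hermiteWeight a b c) (P - R) S =
      form (hermiteWeight a b c) P S - form (hermiteWeight a b c) R S := by
  ext1 i j
  simp [form_hermiteWeight, sub_mul, Finset.sum_sub_distrib]

theorem form_add_right (a b c : ℝ) (P R S : MatPoly 3) :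
    form (hermiteWeight a b c) P (R + S) =
      form (hermiteWeight a b c) P R + form (hermiteWeight a b c) P S := by
  ext1 i j
  simp [form_hermiteWeight, add_mul, mul_add, conjPoly_add, Finset.sum_add_distrib]

theorem form_zero_right (a b c : ℝ) (P : MatPoly 3) :
    form (hermiteWeight a b c) P 0 = 0 := by
  ext1 i j
  simp [form_hermiteWeight, conjPoly]

theorem form_constMat_mul_left (a b c : ℝ) (M : Matrix (Fin 3) (Fin 3) ℂ) (P S : MatPoly 3) :
    form (hermiteWeight a b c) (constMat M * P) S = M * form (hermiteWeight a b c) P S := by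
  ext1 i j
  rw [form_hermiteWeight, Matrix.mul_apply]
  simp only [form_hermiteWeight, mul_assoc, constMat_mul_apply, Fin.sum_univ_three, add_mul,
    smul_mul_assoc, map_add, map_smul, smul_eq_mul]
  ring

theorem form_constMat_mul_right (a b c : ℝ) (M : Matrix (Fin 3) (Fin 3) ℂ) (P S : MatPoly 3) :
    form (hermiteWeight a b c) P (constMat M * S) =
      form (hermiteWeight a b c) P S * M.conjTranspose := by
  ext1 i j
  rw [form_hermiteWeight, Matrix.mul_apply]
  simp only [form_hermiteWeight, mul_assoc, constMat_mul_apply, Fin.sum_univ_three, mul_add,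
    conjPoly_add, conjPoly_smul, mul_smul_comm, map_add, map_smul, smul_eq_mul,
    Matrix.conjTranspose_apply, RCLike.star_def]
  ring

/-- Each diagonal entry is a sum of three integrals of squared moduli against positive densities. -/
theorem eq_zero_of_form_self (a b c : ℝ) (P : MatPoly 3)
    (h : form (hermiteWeight a b c) P P = 0) : P = 0 := by
  have hT : P * unipotent a c = 0 := by
    ext1 i k
    have hi := congrFun (congrFun h i) i
    rw [form_hermiteWeight] at hi
    simp only [gaussInt_mul_conjPoly, ← Complex.ofReal_sum, Matrix.zero_apply,
      Complex.ofReal_eq_zero] at hi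
    exact eq_zero_of_integral_normSq _ _
      ((Finset.sum_eq_zero_iff_of_nonneg fun k _ => integral_normSq_nonneg _ _).mp hi k
        (Finset.mem_univ k))
  rw [← mul_unipotent_mul_inv a c P, hT, zero_mul]

/-- Orthogonal sequences for `hermiteWeight` are unique up to constant invertible left factors. -/
theorem IsOrthogonalSequence.exists_eq_constMat_mul {a b c : ℝ} {Q R : ℕ → MatPoly 3}
    (hQ : IsOrthogonalSequence (hermiteWeight a b c) Q)
    (hR : IsOrthogonalSequence (hermiteWeight a b c) R) (n : ℕ) :
    ∃ M : Matrix (Fin 3) (Fin 3) ℂ, Q n = constMat M * R n := by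
  have horth : ∀ {Q : ℕ → MatPoly 3}, IsOrthogonalSequence (hermiteWeight a b c) Q →
      ∀ S : MatPoly 3, (∀ k ≥ n, coeffMat S k = 0) → form (hermiteWeight a b c) (Q n) S = 0 := by
    intro Q hQ S hS
    refine induction_of_leading hQ.degree_le hQ.leading
      (fun S => form (hermiteWeight a b c) (Q n) S = 0) (form_zero_right a b c _)
      (fun P R hP hR => ?_) n (fun k hk M => ?_) S hS
    · rw [form_add_right, hP, hR, add_zero]
    · rw [form_constMat_mul_right, hQ.orthogonal n k (by omega), zero_mul]
  set M := coeffMat (Q n) n * (coeffMat (R n) n)⁻¹ with hM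
  refine ⟨M, sub_eq_zero.mp (eq_zero_of_form_self a b c _ ?_)⟩
  -- Matching leading coefficients leaves a difference of degree below `n`, to which both `Q n` and
  -- `R n` are orthogonal; hence it is orthogonal to itself.
  have hdeg : ∀ k ≥ n, coeffMat (Q n - constMat M * R n) k = 0 := by
    intro k hk
    rw [coeffMat_sub, coeffMat_constMat_mul]
    rcases eq_or_lt_of_le hk with rfl | hk
    · rw [hM, mul_assoc, Matrix.nonsing_inv_mul _ (hR.leading n).isUnit, mul_one, sub_self]
    · rw [hQ.degree_le n k hk, hR.degree_le n k hk, mul_zero, sub_zero]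
  rw [form_sub_left, form_constMat_mul_left, horth hQ _ hdeg, horth hR _ hdeg, mul_zero, sub_zero]

theorem IsOrthogonalSequence.eigenAlgebra_le {a b c : ℝ} {Q R : ℕ → MatPoly 3}
    (hQ : IsOrthogonalSequence (hermiteWeight a b c) Q)
    (hR : IsOrthogonalSequence (hermiteWeight a b c) R) : eigenAlgebra Q ≤ eigenAlgebra R := by
  rintro D ⟨hD, hD'⟩
  refine ⟨hD, fun n => ?_⟩
  obtain ⟨M, hM⟩ := hR.exists_eq_constMat_mul hQ n
  obtain ⟨L, hL⟩ := hQ.exists_eq_constMat_mul hR n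
  obtain ⟨Γ, hΓ⟩ := hD' n
  refine ⟨M * Γ * L, ?_⟩
  rw [hM, act_constMat_mul hD, hΓ, constMat_mul, constMat_mul, ← hM, mul_assoc, mul_assoc, ← hL]

/-! ### The two operators lie in the eigenvalue algebra. -/

theorem isDiffOp_coefOp {N : ℕ} (F : MatPoly N) : IsDiffOp (coefOp F) := by
  simpa using isDiffOp_term 0 F

theorem coefOp_one {N : ℕ} : coefOp (1 : MatPoly N) = 1 := by
  apply MulOpposite.unop_injective
  ext1 P
  simp [coefOp]

theorem isDiffOp_opD₁ (a b c : ℝ) : IsDiffOp (opD₁ a b c) := by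
  have h := isDiffOp_term 2 (1 : MatPoly 3)
  rw [coefOp_one, mul_one] at h
  have h1 := fun F : MatPoly 3 => isDiffOp_term 1 F
  simp only [pow_one] at h1
  exact (h.add (h1 _)).add (isDiffOp_coefOp _)

theorem isDiffOp_opD₂ (a c : ℝ) : IsDiffOp (opD₂ a c) := by
  have h1 := fun F : MatPoly 3 => isDiffOp_term 1 F
  simp only [pow_one] at h1
  exact ((isDiffOp_term 2 _).add (h1 _)).add (isDiffOp_coefOp _)

theorem act_hermSeq_of_conj (a b c : ℝ) {D : RightOp 3} (E : MatPoly 3 → MatPoly 3)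
    (hE : ∀ P, act P D * unipotent a c = E (P * unipotent a c)) {n : ℕ}
    {M : Matrix (Fin 3) (Fin 3) ℂ}
    (h : E (hermSeqConj a b c n) = constMat M * hermSeqConj a b c n) :
    act (hermSeq a b c n) D = constMat M * hermSeq a b c n := by
  rw [← mul_unipotent_mul_inv a c (act _ D), hE, hermSeq_mul_unipotent, h, mul_assoc, hermSeq]

theorem raise_derivative_derivative_herm (β : ℝ) (n : ℕ) :
    raise β (derivative (derivative (herm β n))) = (n - 1 : ℂ) • derivative (herm β n) := by
  have h := congrArg derivative (raise_derivative_herm β n)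
  rw [derivative_raise, derivative_smul] at h
  rw [eq_sub_of_add_eq h]
  module

theorem opD₁_mem_eigenAlgebra (a b c : ℝ) : opD₁ a b c ∈ eigenAlgebra (hermSeq a b c) := by
  refine ⟨isDiffOp_opD₁ a b c, fun n => ⟨!![-2 * n, 0, 0; 0, -2 * n + 2, 0; 0, 0, -2 * n],
    act_hermSeq_of_conj a b c (diagOp₁ b) (act_opD₁_mul_unipotent a b c) ?_⟩⟩
  ext1 i j
  rw [constMat_mul_apply, Fin.sum_univ_three]
  fin_cases i <;> fin_cases j <;>
    simp [-Complex.coe_smul, diagOp₁, hermSeqConj, raise_derivative_herm,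
      raise_derivative_derivative_herm] <;> module

theorem opD₂_mem_eigenAlgebra (a b c : ℝ) (hc : c ≠ 0) :
    opD₂ a c ∈ eigenAlgebra (hermSeq a b c) := by
  have hc' : (c : ℂ) ≠ 0 := by exact_mod_cast hc
  refine ⟨isDiffOp_opD₂ a c, fun n => ⟨!![2 + 4 / c ^ 2, 0, -(2 * a / c) * (n + 1);
    0, 2 + 4 / c ^ 2, 0; 0, 0, -2 * n],
    act_hermSeq_of_conj a b c (diagOp₂ c) (act_opD₂_mul_unipotent a c hc) ?_⟩⟩
  ext1 i j
  rw [constMat_mul_apply, Fin.sum_univ_three]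
  fin_cases i <;> fin_cases j <;>
    simp [-Complex.coe_smul, diagOp₂, hermSeqConj, raise_derivative_herm, raise_herm,
      derivative_herm_succ] <;>
    match_scalars <;> field_simp <;> ring


/-! ### Scalar components of an eigenoperator. -/

/-- The scalar components of a matrix differential operator. -/
theorem IsDiffOp.exists_components {N : ℕ} {D : RightOp N} (hD : IsDiffOp D) :
    ∃ e : Fin N → Fin N → Module.End ℂ ℂ[X], (∀ i j, e i j ∈ weyl) ∧
      ∀ (P : MatPoly N) (k j : Fin N), act P D k j = ∑ i, e i j (P k i) := by
  obtain ⟨m, F, rfl⟩ := hD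
  refine ⟨fun i j => ∑ l ∈ Finset.range (m + 1),
    LinearMap.mulLeft ℂ (F l i j) * (Polynomial.derivative : Module.End ℂ ℂ[X]) ^ l,
    fun i j => sum_mem fun l _ => mul_mem (mulLeft_mem_weyl _) (pow_mem derivative_mem_weyl _),
    fun P k j => ?_⟩
  rw [act_sumOp, Matrix.sum_apply]
  simp only [Matrix.mul_apply, Matrix.map_apply, LinearMap.sum_apply, Module.End.mul_apply,
    Module.End.pow_apply, LinearMap.mulLeft_apply]
  rw [Finset.sum_comm]
  exact Finset.sum_congr rfl fun i _ => Finset.sum_congr rfl fun l _ => mul_comm _ _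

/-- The scalar operators `e i j` are the components of an operator that has every `hermSeqConj n`
as an eigenfunction. -/
def IsEigenFamily (a b c : ℝ) (e : Fin 3 → Fin 3 → Module.End ℂ ℂ[X]) : Prop :=
  (∀ i j, e i j ∈ weyl) ∧ ∀ n, ∃ M : Matrix (Fin 3) (Fin 3) ℂ, ∀ k j,
    ∑ i, e i j (hermSeqConj a b c n k i) = ∑ l, M k l • hermSeqConj a b c n l j

theorem exists_isEigenFamily {a b c : ℝ} {D : RightOp 3}
    (hD : D ∈ eigenAlgebra (hermSeq a b c)) :
    ∃ e : Fin 3 → Fin 3 → Module.End ℂ ℂ[X], IsEigenFamily a b c e ∧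
      ∀ (Y : MatPoly 3) (k j : Fin 3),
        (act (Y * unipotentInv a c) D * unipotent a c) k j = ∑ i, e i j (Y k i) := by
  obtain ⟨hD, hD'⟩ := hD
  have hE : IsDiffOp (coefOp (unipotentInv a c) * D * coefOp (unipotent a c)) :=
    ((isDiffOp_coefOp _).mul hD).mul (isDiffOp_coefOp _)
  obtain ⟨e, he, h⟩ := hE.exists_components
  have h' : ∀ (Y : MatPoly 3) (k j : Fin 3),
      (act (Y * unipotentInv a c) D * unipotent a c) k j = ∑ i, e i j (Y k i) := fun Y k j => by
    rw [← h, act_mul, act_mul, act_coefOp, act_coefOp]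
  refine ⟨e, ⟨he, fun n => ?_⟩, h'⟩
  obtain ⟨M, hM⟩ := hD' n
  refine ⟨M, fun k j => ?_⟩
  rw [← h', ← constMat_mul_apply, ← hermSeq, hM, mul_assoc, hermSeq_mul_unipotent]

theorem hermCoeff_derivative (β : ℝ) (k : ℕ) (p : ℂ[X]) :
    hermCoeff β k (derivative p) = (k + 1 : ℂ) * hermCoeff β (k + 1) p := by
  rw [hermCoeff_succ, mul_inv_cancel_left₀ (Nat.cast_add_one_ne_zero k)]

theorem hermCoeff_hermSeqConj (a b c : ℝ) {k n : ℕ} (h : k + 1 < n) (l j : Fin 3) :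
    hermCoeff (centre b j) k (hermSeqConj a b c n l j) = 0 := by
  have h1 : k ≠ n := by omega
  have h2 : k + 1 ≠ n := by omega
  have h3 : k ≠ n + 1 := by omega
  fin_cases l <;> fin_cases j <;>
    simp [-Complex.coe_smul, hermSeqConj, centre, hermCoeff_derivative, hermCoeff_herm, h1, h2, h3]

theorem IsEigenFamily.hermCoeff_row {a b c : ℝ} {e : Fin 3 → Fin 3 → Module.End ℂ ℂ[X]}
    (h : IsEigenFamily a b c e) {k n : ℕ} (hk : k + 1 < n) (l j : Fin 3) :
    hermCoeff (centre b j) k (∑ i, e i j (hermSeqConj a b c n l i)) = 0 := by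
  obtain ⟨M, hM⟩ := h.2 n
  rw [hM, map_sum]
  exact Finset.sum_eq_zero fun i _ => by
    rw [map_smul, hermCoeff_hermSeqConj a b c hk, smul_zero]

/-- Three rows of the eigenvalue equation give a homogeneous linear system in these three
coefficients. Its determinant is positive, so each component separately obeys the band bound of the
rows. -/
theorem IsEigenFamily.hermCoeff_eq_zero {a b c : ℝ} {e : Fin 3 → Fin 3 → Module.End ℂ ℂ[X]}
    (h : IsEigenFamily a b c e) {k n : ℕ} (hk : k + 1 < n) (j : Fin 3) :
    hermCoeff (centre b j) k (e 0 j (herm b n)) = 0 ∧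
    hermCoeff (centre b j) k (e 1 j (herm 0 (n + 1))) = 0 ∧
    hermCoeff (centre b j) k (e 2 j (herm 0 n)) = 0 := by
  have hu := h.hermCoeff_row hk 0 j
  have hv := h.hermCoeff_row hk 2 j
  -- Row 1 is taken at level `n + 1`, where its derivatives become multiples of `H_n` and the same
  -- three unknowns occur.
  have hr := h.hermCoeff_row (hk.trans n.lt_succ_self) 1 j
  simp only [hermSeqConj, Fin.sum_univ_three, Matrix.of_apply, Matrix.cons_val, map_zero,
    map_smul, map_add, add_zero, zero_add, smul_eq_mul, derivative_herm_succ] at hu hv hr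
  push_cast at hr
  set A := hermCoeff (centre b j) k (e 0 j (herm b n))
  set B := hermCoeff (centre b j) k (e 1 j (herm 0 (n + 1)))
  set C' := hermCoeff (centre b j) k (e 2 j (herm 0 n))
  have h3 : (0 : ℝ) < 1 + (n + 1) / 2 * (a ^ 2 * massRatio b + c ^ 2) := by
    have := (massRatio_pos b).le
    positivity
  have h4 : ((1 + (n + 1) / 2 * (a ^ 2 * massRatio b + c ^ 2) : ℝ) : ℂ) ≠ 0 := by
    exact_mod_cast h3.ne'
  have hB : B = 0 := by
    refine (mul_eq_zero.mp ?_).resolve_left h4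
    push_cast
    linear_combination hr + (n + 1) / 2 * (a * massRatio b * hu + c * hv)
  rw [hB] at hu hv
  refine ⟨by simpa using hu, hB, by simpa using hv⟩

/-- The components of an eigenoperator that connect different exponential types vanish. -/
theorem IsEigenFamily.block {a b c : ℝ} (hb : b ≠ 0) {e : Fin 3 → Fin 3 → Module.End ℂ ℂ[X]}
    (h : IsEigenFamily a b c e) : e 0 1 = 0 ∧ e 0 2 = 0 ∧ e 1 0 = 0 ∧ e 2 0 = 0 := by
  refine ⟨?_, ?_, ?_, ?_⟩
  · exact eq_zero_of_banded_of_ne hb (h.1 _ _) fun k =>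
      ⟨k + 2, fun n hn => (h.hermCoeff_eq_zero (by omega : k + 1 < n) 1).1⟩
  · exact eq_zero_of_banded_of_ne hb (h.1 _ _) fun k =>
      ⟨k + 2, fun n hn => (h.hermCoeff_eq_zero (by omega : k + 1 < n) 2).1⟩
  · refine eq_zero_of_banded_of_ne hb.symm (h.1 _ _) fun k => ⟨k + 3, fun n hn => ?_⟩
    obtain ⟨n, rfl⟩ : ∃ m, n = m + 1 := ⟨n - 1, by omega⟩
    exact (h.hermCoeff_eq_zero (by omega : k + 1 < n) 0).2.1
  · exact eq_zero_of_banded_of_ne hb.symm (h.1 _ _) fun k =>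
      ⟨k + 2, fun n hn => (h.hermCoeff_eq_zero (by omega : k + 1 < n) 0).2.2⟩

/-- The eigenvalue relations for a block diagonal family, at level `n`. -/
theorem IsEigenFamily.rows {a b c : ℝ} (hb : b ≠ 0) {e : Fin 3 → Fin 3 → Module.End ℂ ℂ[X]}
    (h : IsEigenFamily a b c e) (n : ℕ) : ∃ M : Matrix (Fin 3) (Fin 3) ℂ,
    (e 0 0 (herm b n) = M 0 0 • herm b n +
      M 0 1 • ((-(a * massRatio b / 2) : ℝ) : ℂ) • derivative (herm b n)) ∧
    ((a : ℂ) • e 1 1 (herm 0 (n + 1)) = M 0 0 • (a : ℂ) • herm 0 (n + 1) + M 0 1 • herm 0 n +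
      M 0 2 • (c : ℂ) • herm 0 (n + 1)) ∧
    ((a : ℂ) • e 1 2 (herm 0 (n + 1)) =
      M 0 1 • ((-(c / 2) : ℝ) : ℂ) • derivative (herm 0 n) + M 0 2 • herm 0 n) ∧
    (((-(a * massRatio b / 2) : ℝ) : ℂ) • e 0 0 (derivative (herm b n)) = M 1 0 • herm b n +
      M 1 1 • ((-(a * massRatio b / 2) : ℝ) : ℂ) • derivative (herm b n)) ∧
    (e 1 1 (herm 0 n) + ((-(c / 2) : ℝ) : ℂ) • e 2 1 (derivative (herm 0 n)) =
      M 1 0 • (a : ℂ) • herm 0 (n + 1) + M 1 1 • herm 0 n + M 1 2 • (c : ℂ) • herm 0 (n + 1)) ∧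
    (e 1 2 (herm 0 n) + ((-(c / 2) : ℝ) : ℂ) • e 2 2 (derivative (herm 0 n)) =
      M 1 1 • ((-(c / 2) : ℝ) : ℂ) • derivative (herm 0 n) + M 1 2 • herm 0 n) ∧
    (0 = M 2 0 • herm b n +
      M 2 1 • ((-(a * massRatio b / 2) : ℝ) : ℂ) • derivative (herm b n)) ∧
    ((c : ℂ) • e 1 1 (herm 0 (n + 1)) + e 2 1 (herm 0 n) = M 2 0 • (a : ℂ) • herm 0 (n + 1) +
      M 2 1 • herm 0 n + M 2 2 • (c : ℂ) • herm 0 (n + 1)) ∧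
    ((c : ℂ) • e 1 2 (herm 0 (n + 1)) + e 2 2 (herm 0 n) =
      M 2 1 • ((-(c / 2) : ℝ) : ℂ) • derivative (herm 0 n) + M 2 2 • herm 0 n) := by
  obtain ⟨h01, h02, h10, h20⟩ := h.block hb
  obtain ⟨M, hM⟩ := h.2 n
  refine ⟨M, ?_, ?_, ?_, ?_, ?_, ?_, ?_, ?_, ?_⟩
  · simpa [-Complex.coe_smul, hermSeqConj, Fin.sum_univ_three, h01, h02, h10, h20] using hM 0 0
  · simpa [-Complex.coe_smul, hermSeqConj, Fin.sum_univ_three, h01, h02, h10, h20] using hM 0 1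
  · simpa [-Complex.coe_smul, hermSeqConj, Fin.sum_univ_three, h01, h02, h10, h20] using hM 0 2
  · simpa [-Complex.coe_smul, hermSeqConj, Fin.sum_univ_three, h01, h02, h10, h20] using hM 1 0
  · simpa [-Complex.coe_smul, hermSeqConj, Fin.sum_univ_three, h01, h02, h10, h20] using hM 1 1
  · simpa [-Complex.coe_smul, hermSeqConj, Fin.sum_univ_three, h01, h02, h10, h20] using hM 1 2
  · simpa [-Complex.coe_smul, hermSeqConj, Fin.sum_univ_three, h01, h02, h10, h20] using hM 2 0
  · simpa [-Complex.coe_smul, hermSeqConj, Fin.sum_univ_three, h01, h02, h10, h20] using hM 2 1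
  · simpa [-Complex.coe_smul, hermSeqConj, Fin.sum_univ_three, h01, h02, h10, h20] using hM 2 2

theorem eq_zero_of_smul_herm_add {β : ℝ} {n : ℕ} (hn : 1 ≤ n) {s r t : ℂ} (ht : t ≠ 0)
    (h : 0 = s • herm β n + r • t • derivative (herm β n)) : s = 0 ∧ r = 0 := by
  obtain ⟨n, rfl⟩ : ∃ m, n = m + 1 := ⟨n - 1, by omega⟩
  rw [derivative_herm_succ] at h
  have h1 := congrArg (hermCoeff β (n + 1)) h
  have h2 := congrArg (hermCoeff β n) h
  simp [hermCoeff_herm, ht, Nat.cast_add_one_ne_zero n] at h1 h2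
  exact ⟨h1.symm, h2⟩

theorem massFactor_ne_zero {a : ℝ} (ha : a ≠ 0) (b : ℝ) :
    ((-(a * massRatio b / 2) : ℝ) : ℂ) ≠ 0 := by
  have := (massRatio_pos b).ne'
  rw [Complex.ofReal_ne_zero]
  simp [ha, this]

/-- The zero entry of row 2 and the diagonality of `e 0 0` kill `M 2 1` and `M 0 1`, which makes `e
1 2` a pure lowering and hence `e 2 2` diagonal. Index 0 is excluded because `H_0' = 0` leaves these
entries of `M` free. -/
theorem IsEigenFamily.diagonal {a b c : ℝ} (ha : a ≠ 0) (hb : b ≠ 0)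
    {e : Fin 3 → Fin 3 → Module.End ℂ ℂ[X]} (h : IsEigenFamily a b c e) :
    (∃ P : ℂ[X], ∀ n : ℕ, 1 ≤ n → e 0 0 (herm b n) = P.eval (n : ℂ) • herm b n) ∧
    ∃ K : ℂ[X], ∀ n : ℕ, 1 ≤ n → e 2 2 (herm 0 n) = K.eval (n : ℂ) • herm 0 n := by
  have ha' : (a : ℂ) ≠ 0 := by exact_mod_cast ha
  have ht := massFactor_ne_zero ha b
  -- Row 0 puts `e 0 0 H_n` in the span of `H_n` and `H_{n-1}`; row 1 at level `n + 1` puts it in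
  -- the span of `H_{n+1}` and `H_n`.
  have h00 : ∀ n k : ℕ, k ≠ n → hermCoeff b k (e 0 0 (herm b n)) = 0 := by
    intro n k hk
    by_cases hkn : k + 1 = n
    · obtain ⟨M, -, -, -, h1, -⟩ := h.rows hb (n + 1)
      have h2 := congrArg (hermCoeff b k) h1
      rw [derivative_herm_succ] at h2
      simp only [map_smul, map_add, hermCoeff_herm, if_neg hk, if_neg (by omega : k ≠ n + 1),
        add_zero, smul_eq_mul, mul_zero] at h2
      exact ((mul_eq_zero.mp h2).resolve_left ht |> mul_eq_zero.mp).resolve_left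
        (Nat.cast_add_one_ne_zero n)
    · obtain ⟨M, h1, -⟩ := h.rows hb n
      rw [h1]
      simp [hermCoeff_derivative, hermCoeff_herm, hk, hkn]
  have e00 : ∀ n, e 0 0 (herm b n) = hermCoeff b n (e 0 0 (herm b n)) • herm b n := by
    intro n
    refine hermCoeff_ext b fun k => ?_
    rw [map_smul, hermCoeff_herm]
    by_cases hk : k = n
    · simp [hk]
    · simp [hk, h00 n k hk]
  refine ⟨?_, ?_⟩
  · obtain ⟨P, hP⟩ := exists_eval_eq_hermCoeff b (h.1 0 0)
    exact ⟨P, fun n _ => by rw [← hP, ← e00]⟩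
  · obtain ⟨K, hK⟩ := exists_eval_eq_hermCoeff 0 (h.1 2 2)
    refine ⟨K, fun n hn => ?_⟩
    obtain ⟨M, h1, -, h3, -, -, -, h7, -, h9⟩ := h.rows hb n
    obtain ⟨-, m01⟩ := eq_zero_of_smul_herm_add hn ht
      (s := M 0 0 - hermCoeff b n (e 0 0 (herm b n))) (r := M 0 1) (by
        have := e00 n
        rw [sub_smul, ← this, sub_add_eq_add_sub, ← h1, sub_self])
    obtain ⟨-, m21⟩ := eq_zero_of_smul_herm_add hn ht h7
    have h12 : e 1 2 (herm 0 (n + 1)) = ((a : ℂ)⁻¹ * M 0 2) • herm 0 n := by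
      rw [mul_smul, eq_inv_smul_iff₀ ha', h3, m01, zero_smul, zero_add]
    rw [h12, m21, zero_smul, zero_add] at h9
    have h22 : e 2 2 (herm 0 n) = (M 2 2 - c * ((a : ℂ)⁻¹ * M 0 2)) • herm 0 n := by
      rw [sub_smul, ← h9]
      module
    have hk := hK n
    rw [h22, map_smul, hermCoeff_herm, if_pos rfl, smul_eq_mul, mul_one] at hk
    rw [h22, hk]

theorem IsEigenFamily.eq_zero {a b c : ℝ} (ha : a ≠ 0) (hb : b ≠ 0)
    {e : Fin 3 → Fin 3 → Module.End ℂ ℂ[X]} (h : IsEigenFamily a b c e)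
    (h00 : ∀ n : ℕ, 1 ≤ n → e 0 0 (herm b n) = 0) (h22 : ∀ n : ℕ, 1 ≤ n → e 2 2 (herm 0 n) = 0) :
    e = 0 := by
  have ha' : (a : ℂ) ≠ 0 := by exact_mod_cast ha
  have ht := massFactor_ne_zero ha b
  obtain ⟨h01, h02, h10, h20⟩ := h.block hb
  have e00 : e 0 0 = 0 := eq_zero_of_eventually_herm b (h.1 _ _) 1 h00
  have e22 : e 2 2 = 0 := eq_zero_of_eventually_herm 0 (h.1 _ _) 1 h22
  have key : ∀ n : ℕ, 1 ≤ n →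
      e 1 2 (herm 0 (n + 1)) = 0 ∧ e 1 1 (herm 0 (n + 1)) = 0 ∧ e 2 1 (herm 0 n) = 0 := by
    intro n hn
    obtain ⟨M, h1, h2, h3, -, -, -, h7, h8, h9⟩ := h.rows hb n
    obtain ⟨M', -, -, -, h4', -, h6', -⟩ := h.rows hb (n + 1)
    rw [e00, LinearMap.zero_apply] at h1
    obtain ⟨m00, m01⟩ := eq_zero_of_smul_herm_add hn ht h1
    rw [e00, LinearMap.zero_apply, smul_zero] at h4'
    obtain ⟨m10, m11⟩ := eq_zero_of_smul_herm_add (by omega) ht h4'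
    obtain ⟨m20, m21⟩ := eq_zero_of_smul_herm_add hn ht h7
    rw [e22, LinearMap.zero_apply, smul_zero, add_zero, m11, zero_smul, zero_add] at h6'
    -- Row 1 makes `e 1 2 H_{n+1}` a multiple of `H_{n+1}`, row 0 a multiple of `H_n`; so both
    -- multiples vanish.
    rw [h6', m01, zero_smul, zero_add] at h3
    have m02 : M 0 2 = 0 := by
      have := congrArg (hermCoeff 0 n) h3
      simpa [-Complex.coe_smul, hermCoeff_herm] using this.symm
    have m12 : M' 1 2 = 0 := by
      have := congrArg (hermCoeff 0 (n + 1)) h3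
      simpa [-Complex.coe_smul, hermCoeff_herm, ha] using this
    have e12 : e 1 2 (herm 0 (n + 1)) = 0 := by rw [h6', m12, zero_smul]
    have e11 : e 1 1 (herm 0 (n + 1)) = 0 := by
      rw [m00, m01, m02] at h2
      simp only [zero_smul, add_zero] at h2
      exact (smul_eq_zero.mp h2).resolve_left ha'
    have m22 : M 2 2 = 0 := by
      rw [e12, e22, m21] at h9
      have := congrArg (hermCoeff 0 n) h9
      simpa [hermCoeff_herm] using this.symm
    refine ⟨e12, e11, ?_⟩
    rw [e11, m20, m21, m22] at h8
    simpa using h8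
  have succ : ∀ n ≥ 2, ∃ m, 1 ≤ m ∧ n = m + 1 := fun n hn => ⟨n - 1, by omega, by omega⟩
  have e12 : e 1 2 = 0 := eq_zero_of_eventually_herm 0 (h.1 _ _) 2 fun n hn => by
    obtain ⟨m, hm, rfl⟩ := succ n hn
    exact (key m hm).1
  have e11 : e 1 1 = 0 := eq_zero_of_eventually_herm 0 (h.1 _ _) 2 fun n hn => by
    obtain ⟨m, hm, rfl⟩ := succ n hn
    exact (key m hm).2.1
  have e21 : e 2 1 = 0 := eq_zero_of_eventually_herm 0 (h.1 _ _) 1 fun n hn => (key n hn).2.2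
  funext i j
  fin_cases i <;> fin_cases j <;> assumption

/-! ### Realising the eigenvalues by polynomials in the two operators. -/

theorem act_sub {N : ℕ} (P : MatPoly N) (D E : RightOp N) :
    act P (D - E) = act P D - act P E := rfl

theorem act_smul {N : ℕ} (r : ℂ) (P : MatPoly N) (D : RightOp N) :
    act (r • P) D = r • act P D := map_smul D.unop r P

theorem act_algebraMap {N : ℕ} (r : ℂ) (P : MatPoly N) :
    act P (algebraMap ℂ (RightOp N) r) = r • P := rfl

theorem act_aeval {N : ℕ} {P : MatPoly N} {D : RightOp N} {r : ℂ} (h : act P D = r • P)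
    (p : ℂ[X]) : act P (aeval D p) = p.eval r • P := by
  induction p using Polynomial.induction_on with
  | C s => rw [aeval_C, act_algebraMap, eval_C]
  | add p q hp hq => rw [map_add, act_add, hp, hq, eval_add, add_smul]
  | monomial n s ih =>
    rw [pow_succ, ← mul_assoc, map_mul, aeval_X, act_mul, ih, act_smul, h, smul_smul]
    simp [mul_assoc]

/-- Every operator in the eigenvalue algebra is `p₁(D₁) + p₂(D₁)(D₂ - 2(c²+2)/c²)`. -/
theorem exists_eq_aeval_add {a b c : ℝ} (ha : a ≠ 0) (hb : b ≠ 0) (hc : c ≠ 0) {D : RightOp 3}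
    (hD : D ∈ eigenAlgebra (hermSeq a b c)) : ∃ p₁ p₂ : ℂ[X],
      D = aeval (opD₁ a b c) p₁ + aeval (opD₁ a b c) p₂ *
        (opD₂ a c - algebraMap ℂ (RightOp 3) (2 * ((c : ℂ) ^ 2 + 2) / (c : ℂ) ^ 2)) := by
  have hc' : (c : ℂ) ≠ 0 := by exact_mod_cast hc
  obtain ⟨e, he, hact⟩ := exists_isEigenFamily hD
  obtain ⟨⟨P, hP⟩, K, hK⟩ := he.diagonal ha hb
  -- The substitution `-X/2` recovers `n` from the eigenvalue `-2n` of `D₁`. The factor `-c²/4`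
  -- inverts the value `-4/c²` of the shifted `D₂` on the last diagonal component; on the first that
  -- value is `0`, so `p₁` alone must match `P`.
  set p₁ : ℂ[X] := P.comp (C (-1 / 2) * X) with hp₁
  set p₂ : ℂ[X] := (C (-(c : ℂ) ^ 2 / 4)) * (K - P).comp (C (-1 / 2) * X) with hp₂
  have half : ∀ n : ℕ, (-1 / 2 : ℂ) * (-2 * n) = n := fun n => by ring
  have ev₁ : ∀ n : ℕ, p₁.eval (-(2 * n) : ℂ) = P.eval (n : ℂ) := fun n => by
    rw [hp₁, ← neg_mul, eval_comp, eval_mul, eval_C, eval_X, half]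
  have ev₂ : ∀ n : ℕ, p₂.eval (-(2 * n) : ℂ) * (-4 / (c : ℂ) ^ 2) =
      K.eval (n : ℂ) - P.eval (n : ℂ) := fun n => by
    rw [hp₂, ← neg_mul, eval_mul, eval_comp, eval_mul, eval_C, eval_C, eval_X, half, eval_sub]
    field_simp
  set F := aeval (opD₁ a b c) p₁ + aeval (opD₁ a b c) p₂ *
    (opD₂ a c - algebraMap ℂ (RightOp 3) (2 * ((c : ℂ) ^ 2 + 2) / (c : ℂ) ^ 2)) with hF
  refine ⟨p₁, p₂, ?_⟩
  have h₁ := opD₁_mem_eigenAlgebra a b c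
  have haev : ∀ p : ℂ[X], aeval (opD₁ a b c) p ∈ eigenAlgebra (hermSeq a b c) := fun p =>
    Algebra.adjoin_le (by simpa using h₁) (aeval_mem_adjoin_singleton ℂ _)
  have hFmem : F ∈ eigenAlgebra (hermSeq a b c) :=
    add_mem (haev _) (mul_mem (haev _) (sub_mem (opD₂_mem_eigenAlgebra a b c hc)
      (algebraMap_mem _ _)))
  obtain ⟨f, hf, hactF⟩ := exists_isEigenFamily (sub_mem hD hFmem)
  have eig : ∀ Y : MatPoly 3, ∀ r : ℂ, diagOp₁ b Y = r • Y → ∀ p : ℂ[X],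
      act (Y * unipotentInv a c) (aeval (opD₁ a b c) p) =
        p.eval r • (Y * unipotentInv a c) := by
    intro Y r hY p
    refine act_aeval ?_ p
    rw [← mul_unipotent_mul_inv a c (act _ _), act_opD₁_mul_unipotent, mul_unipotentInv_mul, hY,
      smul_mul_assoc]
  have hFact : ∀ Y : MatPoly 3, ∀ r : ℂ, diagOp₁ b Y = r • Y →
      act (Y * unipotentInv a c) (D - F) * unipotent a c =
        act (Y * unipotentInv a c) D * unipotent a c - (p₁.eval r • Y + p₂.eval r •
          (diagOp₂ c Y - (2 * ((c : ℂ) ^ 2 + 2) / (c : ℂ) ^ 2) • Y)) := by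
    intro Y r hY
    rw [act_sub, hF, act_add, act_mul, eig Y r hY, eig Y r hY, act_smul, act_sub, act_algebraMap,
      sub_mul, add_mul, smul_mul_assoc, smul_mul_assoc, sub_mul, act_opD₂_mul_unipotent a c hc,
      smul_mul_assoc, mul_unipotentInv_mul]
  -- A matrix with a single nonzero entry `H_n` is an eigenvector of the conjugated `D₁` and
  -- isolates one diagonal component.
  have f00 : ∀ n : ℕ, 1 ≤ n → f 0 0 (herm b n) = 0 := by
    intro n hn
    have hY : diagOp₁ b (Matrix.single 0 0 (herm b n)) =
        (-2 * n : ℂ) • (Matrix.single 0 0 (herm b n) : MatPoly 3) := by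
      ext1 i j
      fin_cases i <;> fin_cases j <;>
        simp [diagOp₁, raise_derivative_herm, smul_smul]
    have h1 := hactF (Matrix.single 0 0 (herm b n)) 0 0
    rw [hFact _ _ hY, Matrix.sub_apply, hact] at h1
    simp [-Complex.coe_smul, Fin.sum_univ_three, diagOp₂] at h1
    have hz : (2 + 4 / (c : ℂ) ^ 2) = 2 * ((c : ℂ) ^ 2 + 2) / (c : ℂ) ^ 2 := by
      field_simp
      ring
    rw [← h1, ev₁, hP n hn, hz, sub_self, smul_zero, add_zero, sub_self]
  have f22 : ∀ n : ℕ, 1 ≤ n → f 2 2 (herm 0 n) = 0 := by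
    intro n hn
    have hY : diagOp₁ b (Matrix.single 2 2 (herm 0 n)) =
        (-2 * n : ℂ) • (Matrix.single 2 2 (herm 0 n) : MatPoly 3) := by
      ext1 i j
      fin_cases i <;> fin_cases j <;>
        simp [diagOp₁, raise_derivative_herm, smul_smul]
    have h1 := hactF (Matrix.single 2 2 (herm 0 n)) 2 2
    rw [hFact _ _ hY, Matrix.sub_apply, hact] at h1
    simp [-Complex.coe_smul, Fin.sum_univ_three, diagOp₂] at h1
    have hz : (2 - 2 * ((c : ℂ) ^ 2 + 2) / (c : ℂ) ^ 2) = -4 / (c : ℂ) ^ 2 := by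
      field_simp
      ring
    rw [← h1, ev₁, hK n hn, ← sub_smul, hz, smul_smul, ev₂, ← add_smul, add_sub_cancel, sub_self]
  have f0 := hf.eq_zero ha hb f00 f22
  have hzero : D - F = 0 := by
    apply MulOpposite.unop_injective
    refine LinearMap.ext fun R => ?_
    change act R (D - F) = 0
    have h1 : act R (D - F) * unipotent a c = 0 := by
      ext1 k j
      rw [← mul_unipotent_mul_inv a c R, hactF, f0]
      simp
    rw [← mul_unipotent_mul_inv a c (act R (D - F)), h1, zero_mul]
  exact sub_eq_zero.mp hzero

end MatrixBochner

end

open MatrixBochner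
theorem theorem5p2 (a b c : ℝ) (ha : a ≠ 0) (hb : b ≠ 0) (hc : c ≠ 0) :
    IsSymmetricOp (hermiteWeight a b c) (opD₁ a b c) ∧
    IsSymmetricOp (hermiteWeight a b c) (opD₂ a c) ∧
    (∃ Q : ℕ → MatPoly 3, IsOrthogonalSequence (hermiteWeight a b c) Q) ∧
    ∀ Q : ℕ → MatPoly 3, IsOrthogonalSequence (hermiteWeight a b c) Q →
      opD₁ a b c ∈ eigenAlgebra Q ∧
      opD₂ a c ∈ eigenAlgebra Q ∧
      (eigenAlgebra Q : Set (RightOp 3)) =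
        (Submodule.span (Algebra.adjoin ℂ ({opD₁ a b c} : Set (RightOp 3)))
          ({1, opD₂ a c} : Set (RightOp 3)) : Set (RightOp 3)) ∧
      ∀ D ∈ eigenAlgebra Q, ∃ p₁ p₂ : Polynomial ℂ,
        D = Polynomial.aeval (opD₁ a b c) p₁ +
          Polynomial.aeval (opD₁ a b c) p₂ *
            (opD₂ a c - algebraMap ℂ (RightOp 3) (2 * ((c : ℂ) ^ 2 + 2) / (c : ℂ) ^ 2)) := by
  refine ⟨isSymmetricOp_opD₁ a b c, isSymmetricOp_opD₂ a b c hc,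
    ⟨_, isOrthogonalSequence_hermSeq a b c⟩, fun Q hQ => ?_⟩
  -- The algebra does not depend on the sequence, so the explicit one may be used.
  rw [le_antisymm (hQ.eigenAlgebra_le (isOrthogonalSequence_hermSeq a b c))
    ((isOrthogonalSequence_hermSeq a b c).eigenAlgebra_le hQ)]
  have h₁ := opD₁_mem_eigenAlgebra a b c
  have h₂ := opD₂_mem_eigenAlgebra a b c hc
  refine ⟨h₁, h₂, Set.Subset.antisymm (fun D hD => ?_) (fun D hD => ?_),
    fun D hD => exists_eq_aeval_add ha hb hc hD⟩
  · obtain ⟨p₁, p₂, rfl⟩ := exists_eq_aeval_add ha hb hc hD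
    set S := Submodule.span (Algebra.adjoin ℂ ({opD₁ a b c} : Set (RightOp 3)))
      ({1, opD₂ a c} : Set (RightOp 3))
    have hsmul : ∀ (p : ℂ[X]) (E : RightOp 3), E ∈ S → aeval (opD₁ a b c) p * E ∈ S :=
      fun p E hE => S.smul_mem ⟨_, aeval_mem_adjoin_singleton ℂ _⟩ hE
    have h1 : (1 : RightOp 3) ∈ S := Submodule.subset_span (by simp)
    have h2 : opD₂ a c ∈ S := Submodule.subset_span (by simp)
    have h3 : ∀ r : ℂ, algebraMap ℂ (RightOp 3) r ∈ S := fun r => by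
      simpa using hsmul (C r) 1 h1
    exact add_mem (by simpa using hsmul p₁ 1 h1) (hsmul _ _ (by
      rw [sub_eq_add_neg, ← map_neg]
      exact add_mem h2 (h3 _)))
  · have hle : Algebra.adjoin ℂ ({opD₁ a b c} : Set (RightOp 3)) ≤
        eigenAlgebra (hermSeq a b c) :=
      Algebra.adjoin_le (by simpa using h₁)
    induction hD using Submodule.span_induction with
    | mem E hE =>
      rcases hE with rfl | rfl
      · exact one_mem _
      · exact h₂
    | zero => exact zero_mem _
    | add E F _ _ hE hF => exact add_mem hE hF
    | smul r E _ hE => exact mul_mem (hle r.2) hE
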